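/- Let $G$ be a countable discrete abelian group acting on a probability space $(X,\mathcal B,\mu)$ by measure-preserving automorphisms $(T_g)_{g\in G}$, and assume the action is ergodic. Write $T_gf=f\circ T_g$. A compact factor of $\mathbf X$ consists of a compact metrizable abelian group $Y$ with its Haar probability measure $m_Y$, a homomorphism $g\mapsto b_g$ from $G$ to $Y$, and a measurable map $\rho:X\to Y$ with $\rho_*\mu=m_Y$ and $\rho(T_gx)=\rho(x)+b_g$ for $\mu$-a.e. $x$, for every $g\in G$. Let $Z$, with rotations $z\mapsto z+\hat g$ and factor map $\pi:X\to Z$, be the Kronecker factor of $\mathbf X$, that is, the maximal compact factor: $Z$ is a compact factor and, for every compact factor $\rho:X\to Y$, the $\sigma$-algebra $\rho^{-1}(\mathrm{Borel}(Y))$ is contained in $\pi^{-1}(\mathrm{Borel}(Z))$ modulo $\mu$-null sets. For $f\in L^\infty(\mu)$ let $E(f|Z)$ be its conditional expectation on $\pi^{-1}(\mathrm{Borel}(Z))$, and let $\tilde f:Z\to\mathbb C$ be the ($m_Z$-a.e. unique) function with $E(f|Z)=\tilde f\circ\pi$ a.e. For $u:G\to L^2(\mu)$ write $\mathrm{UC}\text{-}\lim_{g\in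 G}u_g=u$ if $\frac1{|F_N|}\sum_{g\in F_N}u_g\to u$ in $L^2(\mu)$ for every Følner sequence $(F_N)$ in $G$ (nonempty finite sets with $|(F_N+g)\triangle F_N|/|F_N|\to0$ for all $g\in G$). Let $\varphi,\psi:G\to G$ be homomorphisms such that $\varphi(G)$, $\psi(G)$ and $(\psi-\varphi)(G)$ have finite index in $G$. Then: (1) $Z$ is characteristic for $\{\varphi,\psi\}$: for all $f_1,f_2\in L^\infty(\mu)$, $$\mathrm{UC}\text{-}\lim_{g\in G}\bigl(T_{\varphi(g)}f_1\cdot T_{\psi(g)}f_2-T_{\varphi(g)}E(f_1|Z)\cdot T_{\psi(g)}E(f_2|Z)\bigr)=0\quad\text{in }L^2(\mu).$$ (2) For all $f_1,f_2\in L^\infty(\mu)$, the limit $\mathrm{UC}\text{-}\lim_{g\in G}f_1(T_{\varphi(g)}x)f_2(T_{\psi(g)}x)$ exists in $L^2(\mu)$ and, with $z=\pi(x)$, equals $$\mathrm{UC}\text{-}\lim_{g\in G}\tilde f_1\bigl(z+\widehat{\varphi(g)}\bigr)\tilde f_2\bigl(z+\widehat{\psi(g)}\bigr)=\int_{Z^2}\tilde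 f_1(z+w_1)\,\tilde f_2(z+w_2)\,d\nu_{\varphi,\psi}(w_1,w_2),$$ where $\nu_{\varphi,\psi}$ is the Haar probability measure on the closed subgroup $Z_{\varphi,\psi}=\overline{\{(\widehat{\varphi(g)},\widehat{\psi(g)}):g\in G\}}$ of $Z^2$; the second limit also exists in $L^2(\mu)$, and the integrand is $\nu_{\varphi,\psi}$-integrable for a.e. $x$. -/

import Mathlib

open MeasureTheory Filter Topology
open scoped ENNReal symmDiff

noncomputable section

/-- A Følner sequence in a (discrete) additive group: a sequence of nonempty finite sets `F N`
with `|(F N + g) ∆ F N| / |F N| → 0` for every `g`. -/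
structure IsFolnerSequence {G : Type*} [AddCommGroup G] (F : ℕ → Finset G) : Prop where
  nonempty : ∀ N, (F N).Nonempty
  tendsto_symmDiff : ∀ g : G, Tendsto
    (fun N => ((((fun h => h + g) '' (F N : Set G)) ∆ (F N : Set G)).ncard : ℝ) / ((F N).card : ℝ))
    atTop (𝓝 0)

section

open scoped Pointwise

/-- Comparison with Mathlib's notion for the translation action and the counting measure. -/
theorem isFolnerSequence_iff {G : Type*} [AddCommGroup G] (F : ℕ → Finset G) :
    IsFolnerSequence F ↔ (∀ N, (F N).Nonempty) ∧
      @IsAddFoelner G G ⊤ (@Measure.count G ⊤) _ _ ℕ atTop (fun N => (F N : Set G)) := by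
  let _ : MeasurableSpace G := ⊤
  have : MeasurableSingletonClass G := ⟨fun _ => trivial⟩
  have key : ∀ (hF : ∀ N, (F N).Nonempty) (g : G) (N : ℕ),
      Measure.count ((g +ᵥ (F N : Set G)) ∆ (F N : Set G)) / Measure.count (F N : Set G) =
      ENNReal.ofReal (((((fun h => h + g) '' (F N : Set G)) ∆ (F N : Set G)).ncard : ℝ)
        / ((F N).card : ℝ)) := by
    intro hF g N
    have h1 : (fun h => h + g) '' (F N : Set G) = g +ᵥ (F N : Set G) := by
      rw [← Set.image_vadd]
      exact Set.image_congr' fun x => add_comm x g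
    have hfin : ((g +ᵥ (F N : Set G)) ∆ (F N : Set G)).Finite := by
      rw [← h1]
      exact (((F N).finite_toSet.image _).union (F N).finite_toSet).subset
        Set.symmDiff_subset_union
    have hpos : (0 : ℝ) < (F N).card := by exact_mod_cast (hF N).card_pos
    rw [h1, ENNReal.ofReal_div_of_pos hpos, ENNReal.ofReal_natCast, ENNReal.ofReal_natCast,
      Measure.count_apply_finite _ hfin, Measure.count_apply_finset,
      Set.ncard_eq_toFinset_card _ hfin]
  constructor
  · rintro ⟨h1, h2⟩
    refine ⟨h1, ⟨Eventually.of_forall fun _ => trivial, Eventually.of_forall fun N => ?_,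
      Eventually.of_forall fun N => ?_, fun g => ?_⟩⟩
    · rw [Measure.count_apply_finset]
      exact_mod_cast (h1 N).card_pos.ne'
    · rw [Measure.count_apply_finset]
      exact ENNReal.natCast_ne_top _
    · simp_rw [key h1 g]
      simpa using ENNReal.tendsto_ofReal (h2 g)
  · rintro ⟨h1, h2⟩
    refine ⟨h1, fun g => ?_⟩
    have h3 := h2.tendsto_meas_vadd_symmDiff g
    simp_rw [key h1 g] at h3
    have h4 := (ENNReal.tendsto_toReal ENNReal.zero_ne_top).comp h3
    refine h4.congr fun N => ?_
    exact ENNReal.toReal_ofReal (by positivity)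

end

/-- `UC-lim_{g ∈ G} u g = l` in `L²(μ)`: all `u g` and `l` are square integrable, and
`(1/|F N|) ∑_{g ∈ F N} u g → l` in `L²(μ)` for *every* Følner sequence `F` in `G`. -/
structure IsUCLimL2 {G X : Type*} [AddCommGroup G] [MeasurableSpace X] (μ : Measure X)
    (u : G → X → ℂ) (l : X → ℂ) : Prop where
  memLp : ∀ g, MemLp (u g) 2 μ
  memLp_lim : MemLp l 2 μ
  tendsto : ∀ F : ℕ → Finset G, IsFolnerSequence F →
    Tendsto (fun N => eLpNorm (fun x => ((F N).card : ℂ)⁻¹ * (∑ g ∈ F N, u g x) - l x) 2 μ)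
      atTop (𝓝 0)

/-- The pair `{φ, ψ}` is admissible: `φ`, `ψ` and `ψ - φ` have image of finite index in `G`. -/
structure IsAdmissiblePair {G : Type*} [AddCommGroup G] (φ ψ : G →+ G) : Prop where
  finiteIndex_left : φ.range.FiniteIndex
  finiteIndex_right : ψ.range.FiniteIndex
  finiteIndex_sub : (ψ - φ).range.FiniteIndex

/-- The factor given by the sub-σ-algebra `m` is characteristic for the family `{φ, ψ}`:
for all `f₁, f₂ ∈ L^∞(μ)`,
`UC-lim (T_{φ(g)} f₁ · T_{ψ(g)} f₂ - T_{φ(g)} E(f₁|m) · T_{ψ(g)} E(f₂|m)) = 0` in `L²(μ)`. -/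
def IsCharacteristicFactor {G X : Type*} [AddCommGroup G] [AddAction G X] (m : MeasurableSpace X)
    [MeasurableSpace X] (μ : Measure X) (φ ψ : G →+ G) : Prop :=
  ∀ f₁ f₂ : X → ℂ, MemLp f₁ ∞ μ → MemLp f₂ ∞ μ →
    IsUCLimL2 μ
      (fun (g : G) x => f₁ (φ g +ᵥ x) * f₂ (ψ g +ᵥ x)
        - (μ[f₁|m]) (φ g +ᵥ x) * (μ[f₂|m]) (ψ g +ᵥ x))
      (fun _ => 0)

/-- The Haar probability measure of a compact abelian group. -/
def haarProb (K : Type*) [AddCommGroup K] [TopologicalSpace K] [IsTopologicalAddGroup K]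
    [CompactSpace K] [MeasurableSpace K] [BorelSpace K] : Measure K :=
  Measure.addHaarMeasure ⊤

instance haarProb.instIsProbabilityMeasure (K : Type*) [AddCommGroup K] [TopologicalSpace K]
    [IsTopologicalAddGroup K] [CompactSpace K] [MeasurableSpace K] [BorelSpace K] :
    IsProbabilityMeasure (haarProb K) :=
  ⟨by simpa [haarProb] using
    Measure.addHaarMeasure_self (K₀ := (⊤ : TopologicalSpace.PositiveCompacts K))⟩

/-- The map `π` exhibits the rotation system `S_g z = z + a g` on the compact abelian group `Z`
(with its Haar probability measure) as a factor of the system `X`. As `G` is countable, the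
almost everywhere identities hold simultaneously for all `g` on a set of full measure. -/
structure IsCompactFactor {G X Z : Type*} [AddCommGroup G] [AddAction G X] [MeasurableSpace X]
    (μ : Measure X) [AddCommGroup Z] [TopologicalSpace Z] [IsTopologicalAddGroup Z]
    [CompactSpace Z] [MeasurableSpace Z] [BorelSpace Z] (a : G →+ Z) (π : X → Z) : Prop where
  measurePreserving : MeasurePreserving π μ (haarProb Z)
  equivariant : ∀ g : G, ∀ᵐ x ∂μ, π (g +ᵥ x) = π x + a g

/-- The Kronecker factor: the maximal compact factor. Maximality is in terms of the associated
sub-σ-algebras, modulo null sets: for each compact factor `ρ : X → Y`, every set `ρ⁻¹(B)`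
agrees up to a null set with some `π⁻¹(A)`. (A compact metrizable group has at most continuum
many points, so letting `Y` range over `Type` covers all of them up to isomorphism.) -/
structure IsKroneckerFactor {G X Z : Type*} [AddCommGroup G] [AddAction G X] [MeasurableSpace X]
    (μ : Measure X) [AddCommGroup Z] [TopologicalSpace Z] [IsTopologicalAddGroup Z]
    [CompactSpace Z] [MeasurableSpace Z] [BorelSpace Z] (a : G →+ Z) (π : X → Z) : Prop
    extends IsCompactFactor μ a π where
  maximal : ∀ (Y : Type) [AddCommGroup Y] [TopologicalSpace Y] [IsTopologicalAddGroup Y]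
    [CompactSpace Y] [T2Space Y] [SecondCountableTopology Y] [MeasurableSpace Y] [BorelSpace Y]
    (b : G →+ Y) (ρ : X → Y), IsCompactFactor μ b ρ →
      ∀ B : Set Y, MeasurableSet B → ∃ A : Set Z, MeasurableSet A ∧ ρ ⁻¹' B =ᵐ[μ] π ⁻¹' A

/-- `h` is (a version of) the image `f̃` of `f` under the factor map `π : X → Z`, that is,
`E(f|Z) = f̃ ∘ π`, where `E(f|Z)` is the conditional expectation on `π⁻¹(Borel Z)`. -/
structure IsFactorImage {X Z : Type*} [MeasurableSpace X] [MeasurableSpace Z] (μ : Measure X)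
    (π : X → Z) (f : X → ℂ) (h : Z → ℂ) : Prop where
  aestronglyMeasurable : AEStronglyMeasurable h (μ.map π)
  condExp_eq : μ[f | MeasurableSpace.comap π inferInstance] =ᵐ[μ] h ∘ π

/-- The image of a function under a factor map exists. -/
theorem exists_isFactorImage {X Z : Type*} [MeasurableSpace X] [MeasurableSpace Z] [Nonempty Z]
    (μ : Measure X) (π : X → Z) (f : X → ℂ) : ∃ h, IsFactorImage μ π f h := by
  obtain ⟨h, hh, he⟩ := (stronglyMeasurable_condExp (μ := μ) (f := f)
    (m := MeasurableSpace.comap π inferInstance)).exists_eq_measurable_comp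
  exact ⟨h, hh.aestronglyMeasurable, by rw [he]⟩

/-- For `a : G → Z`, the closed subgroup `Z_{φ,ψ}` of `Z × Z`: the closure of
`{(a (φ g), a (ψ g)) : g ∈ G}`. -/
def pairSubgroup {G Z : Type*} [AddCommGroup G] [AddCommGroup Z] [TopologicalSpace Z]
    [IsTopologicalAddGroup Z] (a : G →+ Z) (φ ψ : G →+ G) : AddSubgroup (Z × Z) :=
  ((a.comp φ).prod (a.comp ψ)).range.topologicalClosure

instance pairSubgroup.instCompactSpace {G Z : Type*} [AddCommGroup G] [AddCommGroup Z]
    [TopologicalSpace Z] [IsTopologicalAddGroup Z] [CompactSpace Z] (a : G →+ Z) (φ ψ : G →+ G) :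
    CompactSpace (pairSubgroup a φ ψ) :=
  isCompact_iff_compactSpace.mp (AddSubgroup.isClosed_topologicalClosure _).isCompact

/-- `ν_{φ,ψ}`: the Haar probability measure of `Z_{φ,ψ}`, regarded as a measure on `Z × Z`. -/
def pairMeasure {G Z : Type*} [AddCommGroup G] [AddCommGroup Z] [TopologicalSpace Z]
    [IsTopologicalAddGroup Z] [CompactSpace Z] [SecondCountableTopology Z] [MeasurableSpace Z]
    [BorelSpace Z] (a : G →+ Z) (φ ψ : G →+ G) : Measure (Z × Z) :=
  (haarProb (pairSubgroup a φ ψ)).map Subtype.val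

end

/-!
Let `U` be the Koopman representation of `G` on `L²(μ)`. The proof splits each function into a part
measurable with respect to the Kronecker factor `Z` and a part that is *weakly mixing*, that is,
orthogonal to all joint eigenvectors of `U`.

*The Kronecker factor contains all eigenfunctions.* By ergodicity an eigenfunction has constant
modulus, so it defines a map to the circle that intertwines the action with rotations. Its values
lie in a single coset of the closure of the group of eigenvalues, so a translate of it is a compact
factor, and maximality of `Z` applies (`IsKroneckerFactor.aestronglyMeasurable_eigenvector`). Hence
a function with `E(f|Z) = 0` is weakly mixing.

*Weakly mixing vectors are mixing in mean.* If `f` is weakly mixing and `φ(G)` has finite index,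
then `⟪U (φ g) f, k⟫` tends to `0` in mean square along Følner sequences
(`UnitaryRep.IsWeaklyMixing.tendsto_finsetAvg_norm_inner_sq`). A weak limit of the averages of the
rank one operators `⟪U (φ g) f, ·⟫ • U (φ g) f` is symmetric, compact by Bessel's inequality, and
commutes with `U (φ g)`. A nonzero eigenvalue of it would give a finite-dimensional `G`-invariant
space of weakly mixing vectors, which must contain a joint eigenvector: a contradiction.

*Characteristic factor.* By the van der Corput lemma
(`IsFolnerSequence.tendsto_finsetAvg_zero_of_correlation`) the double averages of `f₁` and `f₂` are
governed by the averages over `g` of the correlations `⟪u (g + h), u g⟫`, where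
`u g = T_{φ(g)} f₁ · T_{ψ(g)} f₂`. These depend on `g` only through `(ψ - φ) g`, so the mean ergodic
theorem computes their limits; since `(ψ - φ)(G)` has finite index, the limits are combinations of
finitely many eigenfunctions. Mixing in mean of `f₁` along `φ`, or of `f₂` along `ψ`, then shows
that the double averages vanish in the limit (`isUCLimL2_zero_of_isWeaklyMixing_left`).

*The limit on `Z`.* The points `(a (φ g), a (ψ g))` are dense in the compact group `Z_{φ,ψ}`, hence
equidistributed in it along every Følner sequence. This gives the limit formula for continuous
functions (`isUCLimL2_of_continuous`), and for bounded Borel functions by approximation in `L²`. The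
approximation is possible because averaging over translates by a random element, of whatever
distribution, does not increase `L²` norms (`eLpNorm_integral_le_of_le_translate`). For the same
reason null sets of `Z` do not matter in the integrals over `Z_{φ,ψ}`, even if `Z_{φ,ψ}` is a null
set of `Z × Z` (`ae_mul_ae_eq_pairMeasure`).
-/

/-! ### Averages over finite sets and Følner sequences -/

/-- The average `|s|⁻¹ ∑_{g ∈ s} v g` of a vector-valued function over a finite set. -/
noncomputable def finsetAvg {G E : Type*} [AddCommGroup E] [Module ℝ E] (s : Finset G)
    (v : G → E) : E :=
  (s.card : ℝ)⁻¹ • ∑ g ∈ s, v g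

namespace finsetAvg

section Module

variable {G G' E E' : Type*} [AddCommGroup E] [Module ℝ E] [AddCommGroup E'] [Module ℝ E']

theorem add (s : Finset G) (v w : G → E) :
    finsetAvg s (fun g => v g + w g) = finsetAvg s v + finsetAvg s w := by
  simp [finsetAvg, Finset.sum_add_distrib]

theorem sub (s : Finset G) (v w : G → E) :
    finsetAvg s (fun g => v g - w g) = finsetAvg s v - finsetAvg s w := by
  simp [finsetAvg, Finset.sum_sub_distrib, smul_sub]

theorem const {s : Finset G} (hs : s.Nonempty) (x : E) : finsetAvg s (fun _ => x) = x := by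
  have : (s.card : ℝ) ≠ 0 := by exact_mod_cast hs.card_pos.ne'
  rw [finsetAvg, Finset.sum_const, ← Nat.cast_smul_eq_nsmul ℝ, smul_smul, inv_mul_cancel₀ this,
    one_smul]

theorem map (L : E →ₗ[ℝ] E') (s : Finset G) (v : G → E) :
    L (finsetAvg s v) = finsetAvg s (fun g => L (v g)) := by
  simp [finsetAvg, map_sum]

theorem smul {R : Type*} [Monoid R] [DistribMulAction R E] [SMulCommClass ℝ R E] (c : R)
    (s : Finset G) (v : G → E) : finsetAvg s (fun g => c • v g) = c • finsetAvg s v := by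
  simp only [finsetAvg, ← Finset.smul_sum]
  rw [smul_comm]

theorem comm (s : Finset G) (t : Finset G') (v : G → G' → E) :
    finsetAvg s (fun g => finsetAvg t (v g)) = finsetAvg t (fun h => finsetAvg s (v · h)) := by
  simp only [finsetAvg, ← Finset.smul_sum]
  rw [Finset.sum_comm, smul_comm]

theorem sum {ι : Type*} (s : Finset G) (t : Finset ι) (v : ι → G → E) :
    finsetAvg s (fun g => ∑ i ∈ t, v i g) = ∑ i ∈ t, finsetAvg s (v i) := by
  simp only [finsetAvg, ← Finset.smul_sum]
  rw [Finset.sum_comm]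

theorem map_addRightEmbedding [AddCommGroup G] (s : Finset G) (c : G) (v : G → E) :
    finsetAvg (s.map (addRightEmbedding c)) v = finsetAvg s (fun g => v (g + c)) := by
  simp [finsetAvg]

end Module

variable {G E : Type*} [NormedAddCommGroup E] [NormedSpace ℝ E]

theorem mono (s : Finset G) {v w : G → ℝ} (h : ∀ g, v g ≤ w g) :
    finsetAvg s v ≤ finsetAvg s w := by
  simp only [finsetAvg, smul_eq_mul]
  exact mul_le_mul_of_nonneg_left (Finset.sum_le_sum fun g _ => h g) (by positivity)

theorem nonneg (s : Finset G) {v : G → ℝ} (h : ∀ g, 0 ≤ v g) : 0 ≤ finsetAvg s v := by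
  simp only [finsetAvg, smul_eq_mul]
  exact mul_nonneg (by positivity) (Finset.sum_nonneg fun g _ => h g)

theorem norm_le (s : Finset G) (v : G → E) :
    ‖finsetAvg s v‖ ≤ finsetAvg s (fun g => ‖v g‖) := by
  simp only [finsetAvg, norm_smul, norm_inv, smul_eq_mul, RCLike.norm_natCast]
  exact mul_le_mul_of_nonneg_left (norm_sum_le _ _) (by positivity)

theorem le_of_forall_le (s : Finset G) {v : G → ℝ} {C : ℝ} (hC : 0 ≤ C) (h : ∀ g, v g ≤ C) :
    finsetAvg s v ≤ C := by
  rcases s.eq_empty_or_nonempty with rfl | hs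
  · simpa [finsetAvg] using hC
  · exact (mono s h).trans_eq (const hs C)

theorem norm_le_of_forall_le (s : Finset G) {v : G → E} {C : ℝ} (hC : 0 ≤ C)
    (h : ∀ g, ‖v g‖ ≤ C) : ‖finsetAvg s v‖ ≤ C :=
  (norm_le s v).trans (le_of_forall_le s hC h)

/-- The Cauchy–Schwarz inequality for averages. -/
theorem mul_sq_le (s : Finset G) (v w : G → ℝ) :
    finsetAvg s (fun g => v g * w g) ^ 2 ≤
      finsetAvg s (fun g => v g ^ 2) * finsetAvg s (fun g => w g ^ 2) := by
  simp only [finsetAvg, smul_eq_mul]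
  have := mul_le_mul_of_nonneg_left (Finset.sum_mul_sq_le_sq_mul_sq s v w)
    (by positivity : (0 : ℝ) ≤ (s.card : ℝ)⁻¹ ^ 2)
  linarith

theorem sq_le (s : Finset G) (v : G → ℝ) :
    finsetAvg s v ^ 2 ≤ finsetAvg s (fun g => v g ^ 2) := by
  have h := mul_sq_le s v (fun _ => 1)
  simp only [mul_one, one_pow] at h
  refine h.trans (mul_le_of_le_one_right (nonneg s fun g => sq_nonneg _) ?_)
  exact le_of_forall_le s zero_le_one fun _ => le_rfl

theorem tendsto_of_tendsto_sq {F : ℕ → Finset G} {v : G → ℝ} (hv : ∀ g, 0 ≤ v g)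
    (h : Tendsto (fun N => finsetAvg (F N) (fun g => v g ^ 2)) atTop (𝓝 0)) :
    Tendsto (fun N => finsetAvg (F N) v) atTop (𝓝 0) := by
  have h1 := h.sqrt
  rw [Real.sqrt_zero] at h1
  refine squeeze_zero (fun N => nonneg _ hv) (fun N => ?_) h1
  exact Real.le_sqrt_of_sq_le (sq_le _ _)

end finsetAvg

namespace IsFolnerSequence

variable {G : Type*} [AddCommGroup G] {F : ℕ → Finset G}

/-- Translation does not change the average of a bounded function along a Følner sequence,
asymptotically. -/
theorem tendsto_finsetAvg_add_sub (hF : IsFolnerSequence F) {E : Type*} [NormedAddCommGroup E]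
    [NormedSpace ℝ E] {v : G → E} {C : ℝ} (hv : ∀ g, ‖v g‖ ≤ C) (h : G) :
    Tendsto (fun N => finsetAvg (F N) (fun g => v (g + h)) - finsetAvg (F N) v) atTop (𝓝 0) := by
  classical
  have h1 := (hF.tendsto_symmDiff h).const_mul C
  rw [mul_zero] at h1
  refine squeeze_zero_norm (fun N => ?_) h1
  set A : Finset G := (F N).map (addRightEmbedding h) with hA
  have hcoe : ((fun k => k + h) '' (F N : Set G)) ∆ (F N : Set G) =
      ((A \ F N ∪ F N \ A : Finset G) : Set G) := by
    rw [Set.symmDiff_def, Finset.coe_union, Finset.coe_sdiff, Finset.coe_sdiff, hA,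
      Finset.coe_map]
    rfl
  rw [hcoe, Set.ncard_coe_finset, Finset.card_union_of_disjoint
    (Finset.disjoint_left.2 fun x hx hx' => (Finset.mem_sdiff.1 hx).2 (Finset.mem_sdiff.1 hx').1)]
  have h2 : finsetAvg (F N) (fun g => v (g + h)) - finsetAvg (F N) v =
      ((F N).card : ℝ)⁻¹ • (∑ g ∈ A \ F N, v g - ∑ g ∈ F N \ A, v g) := by
    rw [Finset.sum_sdiff_sub_sum_sdiff, smul_sub, hA, Finset.sum_map]
    rfl
  rw [h2, norm_smul, norm_inv, RCLike.norm_natCast]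
  have h3 : ∀ B : Finset G, ‖∑ g ∈ B, v g‖ ≤ C * B.card := fun B => by
    refine (norm_sum_le_of_le B fun g _ => hv g).trans_eq ?_
    rw [Finset.sum_const, nsmul_eq_mul, mul_comm]
  have h4 : ‖∑ g ∈ A \ F N, v g - ∑ g ∈ F N \ A, v g‖ ≤
      C * ((A \ F N).card + (F N \ A).card) :=
    (norm_sub_le _ _).trans (by rw [mul_add]; exact add_le_add (h3 _) (h3 _))
  calc _ ≤ ((F N).card : ℝ)⁻¹ * (C * ((A \ F N).card + (F N \ A).card)) := by gcongr
    _ = _ := by push_cast; ring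

/-- Translates of the members of a Følner sequence, by arbitrary elements, form a Følner
sequence. -/
theorem map_add (hF : IsFolnerSequence F) (c : ℕ → G) :
    IsFolnerSequence fun N => (F N).map (addRightEmbedding (c N)) where
  nonempty N := (hF.nonempty N).map
  tendsto_symmDiff g := by
    refine (hF.tendsto_symmDiff g).congr fun N => ?_
    rw [Finset.card_map]
    congr 2
    have h1 : (((F N).map (addRightEmbedding (c N)) : Finset G) : Set G) =
        (fun h => h + c N) '' (F N : Set G) := by
      rw [Finset.coe_map]; rfl
    have h2 : (fun h => h + g) '' ((fun h => h + c N) '' (F N : Set G)) =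
        (fun h => h + c N) '' ((fun h => h + g) '' (F N : Set G)) := by
      simp only [Set.image_image, add_right_comm]
    rw [h1, h2, ← Set.image_symmDiff (add_left_injective (c N)),
      Set.ncard_image_of_injective _ (add_left_injective (c N))]

/-- If the averages of `γ` along every Følner sequence tend to `0`, then they do so uniformly
over all translates of a given one. -/
theorem exists_forall_finsetAvg_lt (hF : IsFolnerSequence F) {γ : G → ℝ}
    (hγ : ∀ F' : ℕ → Finset G, IsFolnerSequence F' →
      Tendsto (fun N => finsetAvg (F' N) γ) atTop (𝓝 0)) {ε : ℝ} (hε : 0 < ε) :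
    ∃ N, ∀ c, finsetAvg (F N) (fun h => γ (h + c)) < ε := by
  by_contra! hcon
  choose c hc using hcon
  have h1 := (hγ _ (hF.map_add c)).eventually (gt_mem_nhds hε)
  obtain ⟨N, hN⟩ := h1.exists
  rw [finsetAvg.map_addRightEmbedding] at hN
  exact absurd hN (not_lt.2 (hc N))

end IsFolnerSequence

section VanDerCorput

variable {G H : Type*} [NormedAddCommGroup H] [InnerProductSpace ℂ H]

theorem inner_finsetAvg_left (s : Finset G) (v : G → H) (y : H) :
    inner ℂ (finsetAvg s v) y = finsetAvg s (fun g => inner ℂ (v g) y) := by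
  simp only [finsetAvg]
  rw [RCLike.real_smul_eq_coe_smul (K := ℂ), inner_smul_left, sum_inner]
  simp

theorem inner_finsetAvg_right (s : Finset G) (v : G → H) (y : H) :
    inner ℂ y (finsetAvg s v) = finsetAvg s (fun g => inner ℂ y (v g)) := by
  simp only [finsetAvg]
  rw [RCLike.real_smul_eq_coe_smul (K := ℂ), inner_smul_right, inner_sum]
  simp

variable [AddCommGroup G] {F : ℕ → Finset G}

/-- The van der Corput lemma along Følner sequences: if the correlations
`Γ h = lim avg_g ⟪u (g + h), u g⟫` tend to `0` in absolute mean along all Følner sequences, then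
the averages of `u` tend to `0`. -/
theorem IsFolnerSequence.tendsto_finsetAvg_zero_of_correlation (hF : IsFolnerSequence F)
    {u : G → H} {C : ℝ} (hu : ∀ g, ‖u g‖ ≤ C) {Γ : G → ℂ}
    (hΓ : ∀ h, Tendsto (fun N => finsetAvg (F N) (fun g => (inner ℂ (u (g + h)) (u g) : ℂ)))
      atTop (𝓝 (Γ h)))
    (hΓ0 : ∀ F' : ℕ → Finset G, IsFolnerSequence F' →
      Tendsto (fun N => finsetAvg (F' N) (fun h => ‖Γ h‖)) atTop (𝓝 0)) :
    Tendsto (fun N => finsetAvg (F N) u) atTop (𝓝 0) := by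
  rw [Metric.tendsto_atTop']
  suffices ∀ ε > 0, ∀ᶠ N in atTop, ‖finsetAvg (F N) u‖ < ε by
    intro ε hε
    obtain ⟨N, hN⟩ := eventually_atTop.1 (this ε hε)
    exact ⟨N, fun n hn => by simpa using hN n hn.le⟩
  intro ε hε
  obtain ⟨M, hM⟩ := hF.exists_forall_finsetAvg_lt hΓ0 (ε := (ε / 2) ^ 2) (by positivity)
  set S := F M
  have hS : S.Nonempty := hF.nonempty M
  -- averaging `u` over the translates by the fixed finite set `S` changes nothing in the limit
  set w : G → H := fun g => finsetAvg S (fun h => u (g + h)) with hw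
  have h1 : Tendsto (fun N => finsetAvg (F N) w - finsetAvg (F N) u) atTop (𝓝 0) := by
    have h2 : Tendsto (fun N => (S.card : ℝ)⁻¹ •
        ∑ h ∈ S, (finsetAvg (F N) (fun g => u (g + h)) - finsetAvg (F N) u)) atTop (𝓝 0) := by
      have := (tendsto_finsetSum S fun h _ => hF.tendsto_finsetAvg_add_sub hu h).const_smul
        (S.card : ℝ)⁻¹
      simpa using this
    refine h2.congr fun N => ?_
    have h3 : finsetAvg (F N) w = finsetAvg S (fun h => finsetAvg (F N) (fun g => u (g + h))) :=
      finsetAvg.comm _ _ _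
    have h4 : finsetAvg (F N) u = finsetAvg S (fun _ => finsetAvg (F N) u) :=
      (finsetAvg.const hS _).symm
    rw [h3]; nth_rw 2 [h4]
    rw [← finsetAvg.sub]; rfl
  have h5 : ∀ h h' : G, Tendsto (fun N => finsetAvg (F N)
      (fun g => (inner ℂ (u (g + h)) (u (g + h')) : ℂ))) atTop (𝓝 (Γ (h - h'))) := by
    intro h h'
    have hb : ∀ g, ‖(inner ℂ (u (g + (h - h'))) (u g) : ℂ)‖ ≤ C * C := fun g =>
      (norm_inner_le_norm _ _).trans (mul_le_mul (hu _) (hu _) (norm_nonneg _)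
        ((norm_nonneg _).trans (hu 0)))
    have := (hF.tendsto_finsetAvg_add_sub hb h').add (hΓ (h - h'))
    rw [zero_add] at this
    refine this.congr fun N => ?_
    rw [sub_add_cancel]
    congr 1; ext g; congr 2; abel
  have h6 : Tendsto (fun N => finsetAvg (F N) (fun g => (inner ℂ (w g) (w g) : ℂ))) atTop
      (𝓝 (finsetAvg S fun h' => finsetAvg S fun h => Γ (h - h'))) := by
    have h7 : Tendsto (fun N => finsetAvg S fun h' => finsetAvg S fun h => finsetAvg (F N)
        (fun g => (inner ℂ (u (g + h)) (u (g + h')) : ℂ))) atTop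
        (𝓝 (finsetAvg S fun h' => finsetAvg S fun h => Γ (h - h'))) := by
      simp only [finsetAvg.eq_1 S]
      exact (tendsto_finsetSum S fun h' _ =>
        (tendsto_finsetSum S fun h _ => h5 h h').const_smul _).const_smul _
    refine h7.congr fun N => ?_
    simp only [hw, inner_finsetAvg_left]
    rw [finsetAvg.comm (F N) S]
    simp only [inner_finsetAvg_right]
    rw [finsetAvg.comm S S]
    congr 1; ext h
    rw [finsetAvg.comm]
  have h8 : ‖finsetAvg S fun h' => finsetAvg S fun h => Γ (h - h')‖ < (ε / 2) ^ 2 := by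
    refine (finsetAvg.norm_le _ _).trans_lt ?_
    have h9 : ∀ h', ‖finsetAvg S fun h => Γ (h - h')‖ < (ε / 2) ^ 2 := fun h' => by
      refine (finsetAvg.norm_le _ _).trans_lt ?_
      simpa [sub_eq_add_neg] using hM (-h')
    have hcard : (0 : ℝ) < S.card := by exact_mod_cast hS.card_pos
    rw [← finsetAvg.const hS ((ε / 2) ^ 2)]
    simp only [finsetAvg.eq_1 S, smul_eq_mul]
    exact mul_lt_mul_of_pos_left (Finset.sum_lt_sum_of_nonempty hS fun h' _ => h9 h')
      (inv_pos.2 hcard)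
  filter_upwards [h6.norm.eventually (gt_mem_nhds h8),
    h1.norm.eventually (gt_mem_nhds (show ‖(0 : H)‖ < ε / 2 by simpa using half_pos hε))]
    with N h10 h11
  have h12 : ‖finsetAvg (F N) w‖ ^ 2 < (ε / 2) ^ 2 := by
    refine lt_of_le_of_lt ?_ h10
    calc ‖finsetAvg (F N) w‖ ^ 2 ≤ finsetAvg (F N) (fun g => ‖w g‖) ^ 2 := by
          gcongr; exact finsetAvg.norm_le _ _
      _ ≤ finsetAvg (F N) (fun g => ‖w g‖ ^ 2) := finsetAvg.sq_le _ _
      _ = Complex.reLm (finsetAvg (F N) (fun g => (inner ℂ (w g) (w g) : ℂ))) := by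
          rw [finsetAvg.map]
          congr 1; ext g
          rw [Complex.reLm_coe, ← inner_self_eq_norm_sq (𝕜 := ℂ)]; rfl
      _ ≤ _ := Complex.re_le_norm _
  have h13 : ‖finsetAvg (F N) w‖ < ε / 2 := lt_of_pow_lt_pow_left₀ 2 (by positivity) h12
  calc ‖finsetAvg (F N) u‖ = ‖finsetAvg (F N) w - (finsetAvg (F N) w - finsetAvg (F N) u)‖ := by
        rw [sub_sub_cancel]
    _ ≤ _ := norm_sub_le _ _
    _ < ε := by linarith

end VanDerCorput

/-! ### Unitary representations and the mean ergodic theorem -/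

/-- A unitary representation of an additive group on a Hilbert space. The operators are given as
linear isometries; they are automatically surjective. -/
structure UnitaryRep (G H : Type*) [AddCommGroup G] [NormedAddCommGroup H]
    [InnerProductSpace ℂ H] where
  /-- The operator by which a group element acts. -/
  toFun : G → H →ₗᵢ[ℂ] H
  map_zero' : ∀ x, toFun 0 x = x
  map_add' : ∀ g h x, toFun (g + h) x = toFun g (toFun h x)

namespace UnitaryRep

variable {G H : Type*} [AddCommGroup G] [NormedAddCommGroup H] [InnerProductSpace ℂ H]

instance : CoeFun (UnitaryRep G H) fun _ => G → H →ₗᵢ[ℂ] H := ⟨toFun⟩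

variable (U : UnitaryRep G H)

theorem zero_apply (x : H) : U 0 x = x := U.map_zero' x

theorem add_apply (g h : G) (x : H) : U (g + h) x = U g (U h x) := U.map_add' g h x

theorem neg_apply_apply (g : G) (x : H) : U (-g) (U g x) = x := by
  rw [← U.add_apply, neg_add_cancel, U.zero_apply]

theorem inner_apply_left (g : G) (x y : H) :
    (inner ℂ (U g x) y : ℂ) = inner ℂ x (U (-g) y) := by
  rw [← (U (-g)).inner_map_map (U g x) y, U.neg_apply_apply]

theorem apply_comm (g h : G) (x : H) : U g (U h x) = U h (U g x) := by
  rw [← U.add_apply, ← U.add_apply, add_comm]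

/-- The vectors that are joint eigenvectors of all operators of the representation, the zero
vector included. -/
def IsEigenvector (w : H) : Prop := ∀ g, ∃ c : ℂ, U g w = c • w

/-- The vectors orthogonal to all joint eigenvectors: the weakly mixing part. -/
def IsWeaklyMixing (f : H) : Prop := ∀ w, U.IsEigenvector w → (inner ℂ w f : ℂ) = 0

variable {U}

theorem IsWeaklyMixing.inner_apply_eq_zero {f w : H} (hf : U.IsWeaklyMixing f)
    (hw : U.IsEigenvector w) (g : G) : (inner ℂ w (U g f) : ℂ) = 0 := by
  obtain ⟨c, hc⟩ := hw (-g)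
  rw [← inner_conj_symm, U.inner_apply_left, hc, inner_smul_right, ← inner_conj_symm, hf w hw]
  simp

/-- The mean ergodic theorem along Følner sequences, for the action of `G` through a homomorphism
`θ : G → G`. -/
theorem exists_tendsto_finsetAvg [CompleteSpace H] (U : UnitaryRep G H) (θ : G →+ G) (f : H) :
    ∃ p : H, (∀ g, U (θ g) p = p) ∧ ‖p‖ ≤ ‖f‖ ∧ ∀ F : ℕ → Finset G, IsFolnerSequence F →
      Tendsto (fun N => finsetAvg (F N) (fun g => U (θ g) f)) atTop (𝓝 p) := by
  -- the closed span `D` of the coboundaries; its orthogonal complement consists of fixed vectors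
  set D : Submodule ℂ H :=
    (Submodule.span ℂ (Set.range fun q : G × H => U (θ q.1) q.2 - q.2)).topologicalClosure with hD
  have hgen : ∀ g x, U (θ g) x - x ∈ D := fun g x =>
    Submodule.le_topologicalClosure _ (Submodule.subset_span ⟨(g, x), rfl⟩)
  have : CompleteSpace D := (Submodule.isClosed_topologicalClosure _).completeSpace_coe
  have hfix : ∀ p ∈ Dᗮ, ∀ g, U (θ g) p = p := by
    intro p hp g
    refine sub_eq_zero.1 (inner_self_eq_zero (𝕜 := ℂ).1 ?_)
    have h1 : (inner ℂ (U (θ g) p - p) p : ℂ) = 0 :=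
      (Submodule.mem_orthogonal D p).1 hp _ (hgen g p)
    have h2 : (inner ℂ (U (θ (-g)) p - p) p : ℂ) = 0 :=
      (Submodule.mem_orthogonal D p).1 hp _ (hgen (-g) p)
    rw [inner_sub_left, sub_eq_zero, U.inner_apply_left, map_neg, neg_neg] at h2
    rw [inner_sub_right, h1, sub_zero, inner_sub_left, (U (θ g)).inner_map_map, h2, sub_self]
  have hzero : ∀ F : ℕ → Finset G, IsFolnerSequence F → ∀ d ∈ D,
      Tendsto (fun N => finsetAvg (F N) (fun g => U (θ g) d)) atTop (𝓝 0) := by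
    intro F hF d hd
    have hspan : ∀ d ∈ Submodule.span ℂ (Set.range fun q : G × H => U (θ q.1) q.2 - q.2),
        Tendsto (fun N => finsetAvg (F N) (fun g => U (θ g) d)) atTop (𝓝 0) := by
      intro d hd
      induction hd using Submodule.span_induction with
      | mem x hx =>
        obtain ⟨⟨h, y⟩, rfl⟩ := hx
        refine (hF.tendsto_finsetAvg_add_sub (v := fun g => U (θ g) y) (C := ‖y‖)
          (fun g => ((U (θ g)).norm_map y).le) h).congr fun N => ?_
        rw [← finsetAvg.sub]
        congr 1; ext g
        rw [map_sub, map_add, U.add_apply]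
      | zero => simp [finsetAvg]
      | add x y _ _ hx hy =>
        simpa only [map_add, finsetAvg.add, add_zero] using hx.add hy
      | smul c x _ hx =>
        have := hx.const_smul c
        rw [smul_zero] at this
        refine this.congr fun N => ?_
        simp only [map_smul, finsetAvg, ← Finset.smul_sum]
        rw [smul_comm]
    rw [Metric.tendsto_nhds]
    intro ε hε
    obtain ⟨d', hd', hdd⟩ := Metric.mem_closure_iff.1 hd (ε / 2) (half_pos hε)
    filter_upwards [Metric.tendsto_nhds.1 (hspan d' hd') (ε / 2) (half_pos hε)] with N hN
    rw [dist_zero_right] at hN ⊢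
    have h1 : finsetAvg (F N) (fun g => U (θ g) d) =
        finsetAvg (F N) (fun g => U (θ g) (d - d')) + finsetAvg (F N) (fun g => U (θ g) d') := by
      simp only [map_sub, finsetAvg.sub, sub_add_cancel]
    have h2 : ‖finsetAvg (F N) (fun g => U (θ g) (d - d'))‖ ≤ ‖d - d'‖ :=
      finsetAvg.norm_le_of_forall_le _ (norm_nonneg _) fun g => ((U (θ g)).norm_map _).le
    rw [h1]
    rw [dist_eq_norm] at hdd
    linarith [norm_add_le (finsetAvg (F N) (fun g => U (θ g) (d - d')))
      (finsetAvg (F N) (fun g => U (θ g) d'))]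
  obtain ⟨d, hd, p, hp, rfl⟩ := D.exists_add_mem_mem_orthogonal f
  refine ⟨p, hfix p hp, ?_, fun F hF => ?_⟩
  · have h1 : (inner ℂ d p : ℂ) = 0 := (Submodule.mem_orthogonal D p).1 hp d hd
    have h2 := norm_add_sq_eq_norm_sq_add_norm_sq_of_inner_eq_zero d p h1
    nlinarith [norm_nonneg (d + p), norm_nonneg p, mul_self_nonneg ‖d‖]
  · have h1 := (hzero F hF d hd).add_const p
    rw [zero_add] at h1
    refine h1.congr fun N => ?_
    simp only [map_add, finsetAvg.add, hfix p hp]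
    rw [finsetAvg.const (hF.nonempty N)]

/-- A vector fixed by a subgroup of finite index is a finite sum of joint eigenvectors, whose
eigenvalues are the characters of the finite quotient group. -/
theorem exists_sum_eigenvectors (U : UnitaryRep G H) (N : AddSubgroup G) [N.FiniteIndex] {b : H}
    (hb : ∀ g ∈ N, U g b = b) :
    ∃ e : AddChar (G ⧸ N) ℂ → H, (∀ χ, ‖e χ‖ ≤ ‖b‖) ∧
      (∀ (χ : AddChar (G ⧸ N) ℂ) (g : G), U g (e χ) = χ (QuotientAddGroup.mk g) • e χ) ∧
      ∑ χ, e χ = b := by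
  classical
  have : Fintype (G ⧸ N) := Fintype.ofFinite _
  set B : G ⧸ N → H := fun q => U q.out b with hBdef
  have hB : ∀ g : G, U g b = B (QuotientAddGroup.mk g) := by
    intro g
    obtain ⟨n, hn⟩ := QuotientAddGroup.mk_out_eq_add N g
    simp only [hBdef]
    rw [hn, U.add_apply, hb _ n.2]
  have hUB : ∀ (g : G) (q : G ⧸ N), U g (B q) = B (QuotientAddGroup.mk g + q) := by
    intro g q
    simp only [hBdef]
    rw [← U.add_apply, hB, QuotientAddGroup.mk_add, QuotientAddGroup.out_eq']
  -- the components are the Fourier coefficients of the orbit map on the quotient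
  refine ⟨fun χ => finsetAvg Finset.univ (fun q => χ (-q) • B q), fun χ => ?_, fun χ g => ?_, ?_⟩
  · refine finsetAvg.norm_le_of_forall_le _ (norm_nonneg _) fun q => ?_
    rw [norm_smul, AddChar.norm_apply, one_mul]
    exact ((U _).norm_map b).le
  · have h1 : ∑ q, U g (χ (-q) • B q) = ∑ q, χ (QuotientAddGroup.mk g) • χ (-q) • B q := by
      refine Fintype.sum_equiv (Equiv.addLeft (g : G ⧸ N)) _ _ fun q => ?_
      rw [map_smul, hUB, smul_smul, ← AddChar.map_add_eq_mul]
      simp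
    simp only [finsetAvg]
    rw [RCLike.real_smul_eq_coe_smul (K := ℂ), map_smul, map_sum, h1, ← Finset.smul_sum, smul_comm]
  · simp only [finsetAvg, ← Finset.smul_sum]
    rw [Finset.sum_comm]
    simp only [← Finset.sum_smul]
    have h1 : ∀ q : G ⧸ N, (∑ χ : AddChar (G ⧸ N) ℂ, χ (-q)) • B q =
        if q = 0 then (Fintype.card (G ⧸ N) : ℂ) • b else 0 := by
      intro q
      rw [AddChar.sum_apply_eq_ite]
      by_cases hq : q = 0
      · subst hq
        have : B 0 = b := by rw [← QuotientAddGroup.mk_zero, ← hB, U.zero_apply]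
        simp [this]
      · simp [hq]
    have h2 : (Fintype.card (G ⧸ N) : ℝ) ≠ 0 := by exact_mod_cast Fintype.card_ne_zero
    simp only [h1]
    rw [Finset.sum_ite_eq' Finset.univ]
    simp only [Finset.mem_univ, if_true, Finset.card_univ]
    rw [RCLike.real_smul_eq_coe_smul (K := ℂ), smul_smul]
    have h3 : (Fintype.card (G ⧸ N) : ℂ) ≠ 0 := by exact_mod_cast h2
    simp [h3]

end UnitaryRep

/-! ### The weakly mixing part of a unitary representation -/

section LimitOperator

variable {G H : Type*} [NormedAddCommGroup H] [InnerProductSpace ℂ H]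

/-- A bounded operator `A` for which `∑ i, ‖A (e i)‖ ^ 2` is bounded over all finite orthonormal
families `e` is compact: if the sum is almost maximal for `e`, then `A` is small on the orthogonal
complement of `e`, hence close to an operator of finite rank. -/
theorem isCompactOperator_of_sum_norm_sq_le [CompleteSpace H] {A : H →L[ℂ] H} {C : ℝ}
    (hA : ∀ (n : ℕ) (e : Fin n → H), Orthonormal ℂ e → ∑ i, ‖A (e i)‖ ^ 2 ≤ C) :
    IsCompactOperator A := by
  set T : Set ℝ := {r | ∃ (n : ℕ) (e : Fin n → H), Orthonormal ℂ e ∧ r = ∑ i, ‖A (e i)‖ ^ 2}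
  have hT : BddAbove T := ⟨C, by rintro _ ⟨n, e, he, rfl⟩; exact hA n e he⟩
  have hT0 : T.Nonempty :=
    ⟨_, 0, Fin.elim0, ⟨fun i => i.elim0, fun i => i.elim0⟩, rfl⟩
  refine isClosed_setOfPred_isCompactOperator.closure_subset (a := A) ?_
  rw [Metric.mem_closure_iff]
  intro ε hε
  obtain ⟨_, ⟨n, e, he, rfl⟩, hlt⟩ :=
    exists_lt_of_lt_csSup hT0 (sub_lt_self (sSup T) (by positivity : 0 < (ε / 2) ^ 2))
  set K : Submodule ℂ H := Submodule.span ℂ (Set.range e) with hK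
  have : FiniteDimensional ℂ K := FiniteDimensional.span_of_finite ℂ (Set.finite_range e)
  have hsmall : ∀ y ∈ Kᗮ, ‖A y‖ ≤ ε / 2 * ‖y‖ := by
    intro y hy
    rcases eq_or_ne y 0 with rfl | hy0
    · simp
    have hny : ‖y‖ ≠ 0 := norm_ne_zero_iff.2 hy0
    set u : H := (‖y‖⁻¹ : ℂ) • y with hu
    have hu1 : ‖u‖ = 1 := by
      rw [hu, norm_smul, norm_inv, Complex.norm_real, norm_norm, inv_mul_cancel₀ hny]
    have hue : ∀ i, (inner ℂ (e i) u : ℂ) = 0 := fun i => by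
      rw [hu, inner_smul_right, (Submodule.mem_orthogonal K y).1 hy _
        (Submodule.subset_span ⟨i, rfl⟩), mul_zero]
    have hon : Orthonormal ℂ (Fin.cons u e : Fin (n + 1) → H) := by
      refine ⟨fun i => ?_, fun i j hij => ?_⟩
      · induction i using Fin.cases with
        | zero => simpa using hu1
        | succ i => simpa using he.1 i
      · induction i using Fin.cases with
        | zero =>
          induction j using Fin.cases with
          | zero => exact absurd rfl hij
          | succ j => rw [← inner_conj_symm]; simp [hue]
        | succ i =>
          induction j using Fin.cases with
          | zero => simpa using hue i
          | succ j => simpa using he.2 fun h => hij (by rw [h])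
    have h1 : ‖A u‖ ^ 2 + ∑ i, ‖A (e i)‖ ^ 2 ≤ sSup T := by
      refine le_csSup hT ⟨n + 1, Fin.cons u e, hon, ?_⟩
      rw [Fin.sum_univ_succ]; simp
    have h2 : ‖A u‖ ≤ ε / 2 := by
      refine le_of_lt (lt_of_pow_lt_pow_left₀ 2 (by positivity) ?_)
      linarith
    have h3 : A y = (‖y‖ : ℂ) • A u := by
      rw [hu, map_smul, smul_smul, mul_inv_cancel₀ (by exact_mod_cast hny), one_smul]
    rw [h3, norm_smul, Complex.norm_real, norm_norm, mul_comm]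
    gcongr
  refine ⟨A ∘L K.starProjection, ?_, ?_⟩
  · have h1 : IsCompactOperator (K.subtypeL : K →L[ℂ] H) :=
      isCompactOperator_of_locallyCompactSpace_rng _
    exact (h1.comp_clm K.orthogonalProjectionOnto).clm_comp A
  · rw [dist_eq_norm]
    refine (ContinuousLinearMap.opNorm_le_bound _ (half_pos hε).le fun x => ?_).trans_lt
      (half_lt_self hε)
    have h1 : (A - A ∘L K.starProjection) x = A (x - K.starProjection x) := by simp
    rw [h1]
    refine (hsmall _ (K.sub_starProjection_mem_orthogonal x)).trans ?_
    gcongr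
    have h2 := K.norm_sq_eq_add_norm_sq_starProjection x
    rw [Submodule.starProjection_orthogonal_val] at h2
    nlinarith [norm_nonneg x, sq_nonneg ‖K.starProjection x‖, norm_nonneg (x - K.starProjection x)]

/-- The weak limit, along an ultrafilter, of the averages of the rank one operators
`k ↦ ⟪v g, k⟫ • v g`. -/
theorem exists_limit_operator [CompleteSpace H] (F : ℕ → Finset G) (𝒰 : Ultrafilter ℕ) {v : G → H}
    {C : ℝ} (hv : ∀ g, ‖v g‖ ≤ C) (hC : 0 ≤ C) :
    ∃ A : H →L[ℂ] H, ∀ k l, Tendsto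
      (fun N => finsetAvg (F N) (fun g => (inner ℂ l (v g) * inner ℂ (v g) k : ℂ))) 𝒰
      (𝓝 (inner ℂ l (A k))) := by
  have hbd : ∀ l k : H, ∀ N,
      ‖finsetAvg (F N) (fun g => (inner ℂ l (v g) * inner ℂ (v g) k : ℂ))‖ ≤
        C ^ 2 * ‖l‖ * ‖k‖ := by
    intro l k N
    refine finsetAvg.norm_le_of_forall_le _ (by positivity) fun g => ?_
    rw [norm_mul]
    calc _ ≤ (‖l‖ * ‖v g‖) * (‖v g‖ * ‖k‖) :=
          mul_le_mul (norm_inner_le_norm _ _) (norm_inner_le_norm _ _) (norm_nonneg _)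
            (by positivity)
      _ ≤ (‖l‖ * C) * (C * ‖k‖) := by gcongr <;> exact hv g
      _ = _ := by ring
  have hex : ∀ l k : H, ∃ b : ℂ, ‖b‖ ≤ C ^ 2 * ‖l‖ * ‖k‖ ∧ Tendsto
      (fun N => finsetAvg (F N) (fun g => (inner ℂ l (v g) * inner ℂ (v g) k : ℂ))) 𝒰 (𝓝 b) := by
    intro l k
    obtain ⟨b, hb, hb'⟩ := (isCompact_closedBall (0 : ℂ) (C ^ 2 * ‖l‖ * ‖k‖)).ultrafilter_le_nhds
      (𝒰.map fun N => finsetAvg (F N) (fun g => (inner ℂ l (v g) * inner ℂ (v g) k : ℂ)))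
      (by
        rw [Ultrafilter.coe_map, le_principal_iff, mem_map]
        exact Eventually.of_forall fun N => by simpa using hbd l k N)
    exact ⟨b, by simpa using hb, hb'⟩
  choose b hb hlim using hex
  let L : H →ₗ⋆[ℂ] H →ₗ[ℂ] ℂ := LinearMap.mk₂'ₛₗ (starRingEnd ℂ) (RingHom.id ℂ) b
    (fun l l' k => by
      refine tendsto_nhds_unique (hlim _ _) (((hlim l k).add (hlim l' k)).congr fun N => ?_)
      rw [← finsetAvg.add]; simp only [inner_add_left, add_mul])
    (fun c l k => by
      refine tendsto_nhds_unique (hlim _ _) (((hlim l k).const_smul _).congr fun N => ?_)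
      rw [← finsetAvg.smul]; simp only [inner_smul_left, smul_eq_mul, mul_assoc])
    (fun l k k' => by
      refine tendsto_nhds_unique (hlim _ _) (((hlim l k).add (hlim l k')).congr fun N => ?_)
      rw [← finsetAvg.add]; simp only [inner_add_right, mul_add])
    (fun c l k => by
      refine tendsto_nhds_unique (hlim _ _) (((hlim l k).const_smul c).congr fun N => ?_)
      rw [← finsetAvg.smul]
      simp only [inner_smul_right, smul_eq_mul, mul_left_comm])
  let B : H →L⋆[ℂ] H →L[ℂ] ℂ := L.mkContinuous₂ (C ^ 2) fun l k => hb l k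
  refine ⟨ContinuousLinearMap.adjoint (InnerProductSpace.continuousLinearMapOfBilin B),
    fun k l => ?_⟩
  rw [ContinuousLinearMap.adjoint_inner_right,
    InnerProductSpace.continuousLinearMapOfBilin_apply]
  exact hlim l k

variable {F : ℕ → Finset G} {𝒰 : Ultrafilter ℕ} {v : G → H} {C : ℝ} {A : H →L[ℂ] H}

/-- The operator of the previous lemma is a limit of sums of rank one projections, hence
symmetric. -/
theorem limit_operator_isSymmetric
    (hA : ∀ k l, Tendsto
      (fun N => finsetAvg (F N) (fun g => (inner ℂ l (v g) * inner ℂ (v g) k : ℂ))) 𝒰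
      (𝓝 (inner ℂ l (A k)))) :
    A.IsSymmetric := by
  intro x y
  change (inner ℂ (A x) y : ℂ) = inner ℂ x (A y)
  rw [← inner_conj_symm]
  refine tendsto_nhds_unique (((Complex.continuous_conj.tendsto _).comp (hA x y)).congr
    fun N => ?_) (hA y x)
  change Complex.conjLIE.toLinearEquiv.toLinearMap (finsetAvg (F N) _) = _
  rw [finsetAvg.map]
  congr 1; ext g
  change (starRingEnd ℂ) _ = _
  rw [map_mul, inner_conj_symm, inner_conj_symm, mul_comm]

/-- The limit operator is of Hilbert–Schmidt type, by Bessel's inequality. -/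
theorem limit_operator_isCompact [CompleteSpace H] (hv : ∀ g, ‖v g‖ ≤ C)
    (hA : ∀ k l, Tendsto
      (fun N => finsetAvg (F N) (fun g => (inner ℂ l (v g) * inner ℂ (v g) k : ℂ))) 𝒰
      (𝓝 (inner ℂ l (A k)))) :
    IsCompactOperator A := by
  have hre : ∀ k, Tendsto (fun N => finsetAvg (F N) (fun g => ‖(inner ℂ (v g) k : ℂ)‖ ^ 2)) 𝒰
      (𝓝 (inner ℂ k (A k) : ℂ).re) := by
    intro k
    refine ((Complex.continuous_re.tendsto _).comp (hA k k)).congr fun N => ?_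
    change Complex.reLm (finsetAvg (F N) _) = _
    rw [finsetAvg.map]
    congr 1; ext g
    rw [Complex.reLm_coe, ← inner_conj_symm k, Complex.conj_mul', ← Complex.ofReal_pow,
      Complex.ofReal_re]
  have hnorm : ∀ k, ‖A k‖ ^ 2 ≤ C ^ 2 * (inner ℂ k (A k) : ℂ).re := by
    intro k
    have h1 : ‖(inner ℂ (A k) (A k) : ℂ)‖ ^ 2 ≤
        (C ^ 2 * ‖A k‖ ^ 2) * (inner ℂ k (A k) : ℂ).re := by
      refine le_of_tendsto_of_tendsto' ((hA k (A k)).norm.pow 2) ((hre k).const_mul _) fun N => ?_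
      calc _ ≤ finsetAvg (F N) (fun g => ‖(inner ℂ (A k) (v g) : ℂ)‖ * ‖(inner ℂ (v g) k : ℂ)‖)
              ^ 2 := by
            gcongr
            simpa only [norm_mul] using finsetAvg.norm_le (F N)
              (fun g => (inner ℂ (A k) (v g) * inner ℂ (v g) k : ℂ))
        _ ≤ _ := finsetAvg.mul_sq_le _ _ _
        _ ≤ _ := by
            refine mul_le_mul_of_nonneg_right ?_ (finsetAvg.nonneg _ fun g => sq_nonneg _)
            refine finsetAvg.le_of_forall_le _ (by positivity) fun g => ?_
            rw [← mul_pow]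
            gcongr
            calc _ ≤ ‖A k‖ * ‖v g‖ := norm_inner_le_norm _ _
              _ ≤ ‖A k‖ * C := by gcongr; exact hv g
              _ = _ := mul_comm _ _
    rw [inner_self_eq_norm_sq_to_K, norm_pow, RCLike.norm_ofReal,
      abs_norm] at h1
    rcases eq_or_ne (A k) 0 with h0 | h0
    · simp [h0]
    · have h2 : 0 < ‖A k‖ ^ 2 := by positivity
      nlinarith
  refine isCompactOperator_of_sum_norm_sq_le (C := C ^ 2 * C ^ 2) fun n e he => ?_
  have h1 : ∑ i, (inner ℂ (e i) (A (e i)) : ℂ).re ≤ C ^ 2 := by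
    refine le_of_tendsto' (tendsto_finsetSum Finset.univ fun i _ => hre (e i)) fun N => ?_
    rw [← finsetAvg.sum]
    refine finsetAvg.le_of_forall_le _ (by positivity) fun g => ?_
    have h2 := he.sum_inner_products_le (v g) (s := Finset.univ)
    have h3 : ‖v g‖ ^ 2 ≤ C ^ 2 := by gcongr; exact hv g
    refine le_trans (le_of_eq ?_) (h2.trans h3)
    exact Finset.sum_congr rfl fun i _ => by rw [norm_inner_symm]
  calc ∑ i, ‖A (e i)‖ ^ 2 ≤ ∑ i, C ^ 2 * (inner ℂ (e i) (A (e i)) : ℂ).re :=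
        Finset.sum_le_sum fun i _ => hnorm _
    _ = C ^ 2 * ∑ i, (inner ℂ (e i) (A (e i)) : ℂ).re := by rw [Finset.mul_sum]
    _ ≤ _ := by gcongr

end LimitOperator

namespace UnitaryRep

variable {G H : Type*} [AddCommGroup G] [NormedAddCommGroup H] [InnerProductSpace ℂ H]
  {U : UnitaryRep G H}

/-- Commuting operators on a nonzero finite-dimensional space have a joint eigenvector. -/
theorem exists_isEigenvector_of_finiteDimensional (W : Submodule ℂ H) [FiniteDimensional ℂ W]
    (hW : W ≠ ⊥) (hU : ∀ g, ∀ x ∈ W, U g x ∈ W) : ∃ w ∈ W, w ≠ 0 ∧ U.IsEigenvector w := by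
  induction hn : Module.finrank ℂ W using Nat.strong_induction_on generalizing W with
  | _ n ih =>
  by_cases hall : ∀ g, ∃ c : ℂ, ∀ x ∈ W, U g x = c • x
  · obtain ⟨w, hw, hw0⟩ := W.ne_bot_iff.1 hW
    exact ⟨w, hw, hw0, fun g => (hall g).imp fun c hc => hc w hw⟩
  push Not at hall
  obtain ⟨g, hg⟩ := hall
  have : Nontrivial W := Submodule.nontrivial_iff_ne_bot.2 hW
  obtain ⟨c, hc⟩ := Module.End.exists_eigenvalue ((U g).toLinearMap.restrict (hU g))
  obtain ⟨⟨y, hyW⟩, hy, hy0⟩ := hc.exists_hasEigenvector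
  have hy' : U g y = c • y := congrArg Subtype.val (Module.End.mem_eigenspace_iff.1 hy)
  set W' : Submodule ℂ H := W ⊓ Module.End.eigenspace (U g).toLinearMap c with hW'
  have hmem : ∀ x, x ∈ W' ↔ x ∈ W ∧ U g x = c • x := fun x => by
    rw [hW', Submodule.mem_inf, Module.End.mem_eigenspace_iff]; rfl
  have hlt : W' < W := by
    refine lt_of_le_of_ne inf_le_left fun h => ?_
    obtain ⟨x, hx, hne⟩ := hg c
    exact hne ((hmem x).1 (h ▸ hx)).2
  have : FiniteDimensional ℂ W' := Submodule.finiteDimensional_of_le hlt.le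
  obtain ⟨w, hw, hw0, hwe⟩ := ih _ (hn ▸ Submodule.finrank_lt_finrank_of_lt hlt) W'
    ((Submodule.ne_bot_iff _).2 ⟨y, (hmem y).2 ⟨hyW, hy'⟩, fun h => hy0 (Subtype.ext h)⟩)
    (fun h x hx => by
      rw [hmem] at hx ⊢
      exact ⟨hU h x hx.1, by rw [U.apply_comm, hx.2, map_smul]⟩) rfl
  exact ⟨w, hlt.le hw, hw0, hwe⟩

/-- A weakly mixing vector `f` is mixing in mean, also along a homomorphism `φ` whose image has
finite index. The limit operator of the rank one projections on the orbit of `f` is compact and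
commutes with the operators `U (φ g)`; were it nonzero, it would have a finite-dimensional
eigenspace in the weakly mixing part, whose finitely many translates span a finite-dimensional
invariant subspace, and this contains a joint eigenvector. -/
theorem IsWeaklyMixing.tendsto_finsetAvg_norm_inner_sq [CompleteSpace H] {f : H}
    (hf : U.IsWeaklyMixing f) (φ : G →+ G) [φ.range.FiniteIndex] (k : H) {F : ℕ → Finset G}
    (hF : IsFolnerSequence F) :
    Tendsto (fun N => finsetAvg (F N) (fun g => ‖(inner ℂ (U (φ g) f) k : ℂ)‖ ^ 2)) atTop
      (𝓝 0) := by
  rw [tendsto_iff_ultrafilter]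
  intro 𝒰 h𝒰
  set v : G → H := fun g => U (φ g) f with hvdef
  have hv : ∀ g, ‖v g‖ ≤ ‖f‖ := fun g => ((U (φ g)).norm_map f).le
  obtain ⟨A, hA⟩ := exists_limit_operator F 𝒰 hv (norm_nonneg f)
  -- replacing `g` by `g + h` in the averages does not change the limit, so `A` commutes with
  -- `U (φ h)`
  have hcomm : ∀ g x, A (U (φ g) x) = U (φ g) (A x) := by
    intro h x
    refine ext_inner_left ℂ fun l => ?_
    have h1 : ∀ g, ‖(inner ℂ l (v (g + h)) * inner ℂ (v g) x : ℂ)‖ ≤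
        (‖l‖ * ‖f‖) * (‖f‖ * ‖x‖) := fun g => by
      rw [norm_mul]
      gcongr
      · exact (norm_inner_le_norm _ _).trans (by gcongr; exact hv _)
      · exact (norm_inner_le_norm _ _).trans (by gcongr; exact hv _)
    have h2 := (hF.tendsto_finsetAvg_add_sub h1 (-h)).mono_left h𝒰
    have h3 := h2.add (hA x (U (-φ h) l))
    rw [zero_add] at h3
    have h4 : (inner ℂ (U (-φ h) l) (A x) : ℂ) = inner ℂ l (U (φ h) (A x)) := by
      rw [U.inner_apply_left, neg_neg]
    rw [← h4]
    refine tendsto_nhds_unique (hA (U (φ h) x) l) (h3.congr fun N => ?_)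
    have h5 : finsetAvg (F N) (fun g => (inner ℂ (U (-φ h) l) (v g) * inner ℂ (v g) x : ℂ)) =
        finsetAvg (F N) (fun g => (inner ℂ l (v (g + h)) * inner ℂ (v g) x : ℂ)) := by
      congr 1; ext g
      rw [U.inner_apply_left, neg_neg, hvdef]
      simp only [map_add]
      rw [add_comm, U.add_apply]
    rw [h5, sub_add_cancel]
    congr 1; ext g
    have h6 : v g = U (φ h) (v (g + -h)) := by
      rw [hvdef]
      simp only
      rw [← U.add_apply, ← map_add, add_neg_cancel_comm_assoc]
    rw [neg_add_cancel_right, h6, (U (φ h)).inner_map_map]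
  have hmix : ∀ c : ℂ, c ≠ 0 → ∀ x, A x = c • x → U.IsWeaklyMixing x := by
    intro c hc x hx w hw
    have h1 : (inner ℂ w (A x) : ℂ) = 0 := by
      refine tendsto_nhds_unique (hA x w) (tendsto_const_nhds.congr fun N => ?_)
      simp [finsetAvg, hvdef, hf.inner_apply_eq_zero hw]
    rw [hx, inner_smul_right] at h1
    exact (mul_eq_zero.1 h1).resolve_left hc
  have hcpt := limit_operator_isCompact hv hA
  have hA0 : A = 0 := by
    refine (ContinuousLinearMap.eq_zero_of_forall_hasEigenvalue_eq_zero hcpt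
      (limit_operator_isSymmetric hA)).1 fun c hc => ?_
    by_contra hc0
    set V : Submodule ℂ H := Module.End.eigenspace A.toLinearMap c with hV
    have hVmem : ∀ x, x ∈ V ↔ A x = c • x := fun x => Module.End.mem_eigenspace_iff
    have : FiniteDimensional ℂ V := ContinuousLinearMap.finite_dimensional_eigenspace hcpt c hc0
    set W : Submodule ℂ H := ⨆ q : G ⧸ φ.range, V.map (U q.out).toLinearMap with hW
    have hmemW : ∀ g, ∀ x ∈ V, U g x ∈ W := by
      intro g x hx
      obtain ⟨⟨_, h, rfl⟩, hn⟩ := QuotientAddGroup.mk_out_eq_add φ.range g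
      have h1 : U g x = U (QuotientAddGroup.mk (s := φ.range) g).out (U (φ (-h)) x) := by
        rw [hn, ← U.add_apply, map_neg, add_neg_cancel_right]
      rw [h1]
      refine Submodule.mem_iSup_of_mem (QuotientAddGroup.mk g)
        (Submodule.mem_map_of_mem (f := (U _).toLinearMap) ?_)
      rw [hVmem] at hx ⊢
      rw [hcomm, hx, map_smul]
    have hWinv : ∀ g, ∀ x ∈ W, U g x ∈ W := by
      intro g x hx
      refine Submodule.iSup_induction _ (motive := fun x => U g x ∈ W) hx ?_ ?_ ?_
      · rintro q _ ⟨y, hy, rfl⟩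
        change U g (U q.out y) ∈ W
        rw [← U.add_apply]
        exact hmemW _ _ hy
      · simp
      · intro y z hy hz
        rw [map_add]; exact W.add_mem hy hz
    have hWmix : ∀ x ∈ W, U.IsWeaklyMixing x := by
      intro x hx
      refine Submodule.iSup_induction _ (motive := fun x => U.IsWeaklyMixing x) hx ?_ ?_ ?_
      · rintro q _ ⟨y, hy, rfl⟩ w hw
        exact (hmix c hc0 y ((hVmem y).1 hy)).inner_apply_eq_zero hw _
      · intro w _; simp
      · intro y z hy hz w hw
        rw [inner_add_right, hy w hw, hz w hw, add_zero]
    obtain ⟨x, hx, hx0⟩ := V.ne_bot_iff.1 hc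
    have hWbot : W ≠ ⊥ :=
      W.ne_bot_iff.2 ⟨x, by simpa only [U.zero_apply] using hmemW 0 x hx, hx0⟩
    obtain ⟨w, hwW, hw0, hwe⟩ := exists_isEigenvector_of_finiteDimensional W hWbot hWinv
    exact hw0 (inner_self_eq_zero.1 (hWmix w hwW w hwe))
  have h1 := (hA k k).norm
  rw [hA0] at h1
  simp only [_root_.zero_apply, inner_zero_right, norm_zero] at h1
  refine h1.congr fun N => ?_
  have h2 : (fun g => (inner ℂ k (v g) * inner ℂ (v g) k : ℂ)) =
      fun g => Complex.ofRealLI.toLinearMap (‖(inner ℂ (v g) k : ℂ)‖ ^ 2) := by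
    ext g
    rw [← inner_conj_symm k, Complex.conj_mul', ← Complex.ofReal_pow]; rfl
  rw [h2, ← finsetAvg.map]
  change ‖((finsetAvg (F N) _ : ℝ) : ℂ)‖ = _
  rw [Complex.norm_real, Real.norm_of_nonneg (finsetAvg.nonneg _ fun g => sq_nonneg _)]

/-- Mixing in mean of a weakly mixing vector, without the square. -/
theorem IsWeaklyMixing.tendsto_finsetAvg_norm_inner [CompleteSpace H] {f : H}
    (hf : U.IsWeaklyMixing f) (φ : G →+ G) [φ.range.FiniteIndex] (k : H) {F : ℕ → Finset G}
    (hF : IsFolnerSequence F) :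
    Tendsto (fun N => finsetAvg (F N) (fun g => ‖(inner ℂ (U (φ g) f) k : ℂ)‖)) atTop (𝓝 0) :=
  finsetAvg.tendsto_of_tendsto_sq (fun _ => norm_nonneg _)
    (hf.tendsto_finsetAvg_norm_inner_sq φ k hF)

end UnitaryRep

/-! ### Eigenfunctions of an ergodic action -/

section Koopman

variable {G X : Type*} [AddCommGroup G] [AddAction G X] [MeasurableSpace X]
  [MeasurableConstVAdd G X]

/-- The Koopman representation `(T_g f)(x) = f (g +ᵥ x)` of a measure-preserving action
on `L²(μ)`. -/
noncomputable def koopman (G : Type*) {X : Type*} [AddCommGroup G] [AddAction G X]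
    [MeasurableSpace X] [MeasurableConstVAdd G X] (μ : Measure X) [VAddInvariantMeasure G X μ] :
    UnitaryRep G (Lp ℂ 2 μ) where
  toFun g := Lp.compMeasurePreservingₗᵢ ℂ (g +ᵥ ·) (measurePreserving_vadd g μ)
  map_zero' f := by
    refine Lp.ext ((Lp.coeFn_compMeasurePreserving f (measurePreserving_vadd (0 : G) μ)).trans ?_)
    exact Eventually.of_forall fun x => by simp
  map_add' g h f := by
    refine Lp.ext ((Lp.coeFn_compMeasurePreserving f (measurePreserving_vadd (g + h) μ)).trans ?_)
    refine EventuallyEq.symm ?_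
    refine (Lp.coeFn_compMeasurePreserving _ (measurePreserving_vadd g μ)).trans ?_
    filter_upwards [(measurePreserving_vadd g μ).quasiMeasurePreserving.ae
      (Lp.coeFn_compMeasurePreserving f (measurePreserving_vadd h μ))] with x hx
    refine Eq.trans hx ?_
    simp [vadd_vadd, add_comm]

theorem coeFn_koopman (μ : Measure X) [VAddInvariantMeasure G X μ] (g : G) (f : Lp ℂ 2 μ) :
    koopman G μ g f =ᵐ[μ] fun x => f (g +ᵥ x) :=
  Lp.coeFn_compMeasurePreserving f (measurePreserving_vadd g μ)

theorem ae_vadd_of_ae {μ : Measure X} [VAddInvariantMeasure G X μ] (g : G) {p : X → Prop}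
    (h : ∀ᵐ x ∂μ, p x) : ∀ᵐ x ∂μ, p (g +ᵥ x) :=
  (measurePreserving_vadd g μ).quasiMeasurePreserving.ae h

theorem exists_ae_eq_const_of_forall_vadd (G : Type*) {X : Type*} [AddCommGroup G]
    [AddAction G X] [MeasurableSpace X] {μ : Measure X} [ErgodicVAdd G X μ] {Y : Type*}
    [Nonempty Y] [MeasurableSpace Y] [MeasurableSpace.CountablySeparated Y] {f : X → Y}
    (hf : NullMeasurable f μ) (h : ∀ g : G, (fun x => f (g +ᵥ x)) =ᵐ[μ] f) :
    ∃ c, ∀ᵐ x ∂μ, f x = c := by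
  refine exists_eventuallyEq_const_of_forall_separating MeasurableSet fun U hU => ?_
  refine eventuallyConst_set.1 (aeconst_of_forall_preimage_vadd_ae_eq G (hf hU) fun g => ?_)
  filter_upwards [h g] with x hx
  exact congrArg (fun y => y ∈ U) hx

variable {μ : Measure X} [IsProbabilityMeasure μ] [ErgodicVAdd G X μ]

theorem UnitaryRep.IsEigenvector.norm_eq_one {H : Type*} [NormedAddCommGroup H]
    [InnerProductSpace ℂ H] {U : UnitaryRep G H} {w : H} (hw0 : w ≠ 0) {g : G} {c : ℂ}
    (hc : U g w = c • w) : ‖c‖ = 1 := by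
  have h1 : ‖c‖ * ‖w‖ = ‖w‖ := by rw [← norm_smul, ← hc, (U g).norm_map]
  exact (mul_eq_right₀ (norm_ne_zero_iff.2 hw0)).1 h1

/-- By ergodicity, an eigenfunction has constant modulus. -/
theorem UnitaryRep.IsEigenvector.ae_norm_eq {w : Lp ℂ 2 μ} (hw : (koopman G μ).IsEigenvector w) :
    ∀ᵐ x ∂μ, ‖w x‖ = ‖w‖ := by
  rcases eq_or_ne w 0 with rfl | hw0
  · filter_upwards [Lp.coeFn_zero ℂ 2 μ] with x hx
    rw [hx]; simp
  obtain ⟨r, hr⟩ := exists_ae_eq_const_of_forall_vadd G (μ := μ) (f := fun x => ‖w x‖)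
    (Lp.aestronglyMeasurable w).norm.aemeasurable.nullMeasurable (fun g => by
      obtain ⟨c, hc⟩ := hw g
      have h1 : ‖c‖ = 1 := UnitaryRep.IsEigenvector.norm_eq_one hw0 hc
      filter_upwards [coeFn_koopman μ g w, Lp.coeFn_smul c w] with x hx hx'
      rw [← hx, hc, hx', Pi.smul_apply, norm_smul, h1, one_mul])
  have h0 : 0 ≤ r := by
    obtain ⟨x, hx⟩ := hr.exists
    exact hx ▸ norm_nonneg _
  have h2 : ‖w‖ = r := by
    have h3 : eLpNorm w 2 μ = eLpNorm (fun _ => r) 2 μ := by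
      refine eLpNorm_congr_norm_ae ?_
      filter_upwards [hr] with x hx
      rw [hx, Real.norm_of_nonneg h0]
    rw [Lp.norm_def, h3, eLpNorm_const r two_ne_zero (IsProbabilityMeasure.ne_zero μ)]
    simp [h0]
  rw [h2]
  exact hr

theorem UnitaryRep.IsEigenvector.memLp_top {w : Lp ℂ 2 μ}
    (hw : (koopman G μ).IsEigenvector w) : MemLp w ∞ μ :=
  memLp_top_of_bound (Lp.aestronglyMeasurable w) ‖w‖ (hw.ae_norm_eq.mono fun _ h => h.le)

/-- By ergodicity, every eigenspace is at most one-dimensional. -/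
theorem exists_forall_eigenvector_eq_smul (c : G → ℂ) :
    ∃ e : Lp ℂ 2 μ, MemLp e ∞ μ ∧ ∀ b : Lp ℂ 2 μ, (∀ g, koopman G μ g b = c g • b) →
      ∃ k : ℂ, ‖k‖ ≤ ‖b‖ ∧ b = k • e := by
  by_cases hex : ∃ w : Lp ℂ 2 μ, w ≠ 0 ∧ ∀ g, koopman G μ g w = c g • w
  swap
  · push Not at hex
    refine ⟨0, (MemLp.zero' (ε := ℂ)).ae_eq (Lp.coeFn_zero ℂ 2 μ).symm, fun b hb => ⟨0, ?_, ?_⟩⟩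
    · simp
    · rw [smul_zero]
      by_contra hb0
      obtain ⟨g, hg⟩ := hex b hb0
      exact hg (hb g)
  obtain ⟨w, hw0, hw⟩ := hex
  have hnw : ‖w‖ ≠ 0 := norm_ne_zero_iff.2 hw0
  have hwe : (koopman G μ).IsEigenvector w := fun g => ⟨c g, hw g⟩
  set e : Lp ℂ 2 μ := ((‖w‖⁻¹ : ℝ) : ℂ) • w with he
  have hee : ∀ g, koopman G μ g e = c g • e := fun g => by
    rw [he, map_smul, hw, smul_comm]
  have hev : (koopman G μ).IsEigenvector e := fun g => ⟨c g, hee g⟩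
  have he1 : ‖e‖ = 1 := by
    rw [he, norm_smul, Complex.norm_real, norm_inv, norm_norm, inv_mul_cancel₀ hnw]
  refine ⟨e, hev.memLp_top, fun b hb => ?_⟩
  obtain ⟨k, hk⟩ := exists_ae_eq_const_of_forall_vadd G (μ := μ)
    (f := fun x => b x * (starRingEnd ℂ) (e x))
    ((Lp.aestronglyMeasurable b).mul
      (Complex.continuous_conj.comp_aestronglyMeasurable
        (Lp.aestronglyMeasurable e))).aemeasurable.nullMeasurable (fun g => by
      have h1 : ‖c g‖ = 1 := UnitaryRep.IsEigenvector.norm_eq_one hw0 (hw g)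
      filter_upwards [coeFn_koopman μ g b, Lp.coeFn_smul (c g) b, coeFn_koopman μ g e,
        Lp.coeFn_smul (c g) e] with x h2 h3 h4 h5
      rw [← h2, ← h4, hb, hee, h3, h5, Pi.smul_apply, Pi.smul_apply, smul_eq_mul, smul_eq_mul,
        map_mul]
      have h6 : c g * (starRingEnd ℂ) (c g) = 1 := by
        rw [Complex.mul_conj']; simp [h1]
      linear_combination b x * (starRingEnd ℂ) (e x) * h6)
  have hbe : b = k • e := by
    refine Lp.ext ?_
    filter_upwards [hk, Lp.coeFn_smul k e, hev.ae_norm_eq] with x h1 h2 h3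
    rw [h2, Pi.smul_apply, smul_eq_mul, ← h1, mul_assoc, Complex.conj_mul', h3, he1]
    simp
  exact ⟨k, by rw [hbe, norm_smul, he1, mul_one], hbe⟩

/-- The mean ergodic theorem along a homomorphism `θ` with image of finite index: the limits are
combinations of finitely many bounded functions. -/
theorem exists_forall_tendsto_koopman (θ : G →+ G) [θ.range.FiniteIndex] :
    ∃ e : AddChar (G ⧸ θ.range) ℂ → Lp ℂ 2 μ, (∀ i, MemLp (e i) ∞ μ) ∧
      ∀ f : Lp ℂ 2 μ, ∃ k : AddChar (G ⧸ θ.range) ℂ → ℂ, (∀ i, ‖k i‖ ≤ ‖f‖) ∧ ∀ F : ℕ → Finset G,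
        IsFolnerSequence F →
        Tendsto (fun N => finsetAvg (F N) (fun g => koopman G μ (θ g) f)) atTop
          (𝓝 (∑ i, k i • e i)) := by
  have hex := fun χ : AddChar (G ⧸ θ.range) ℂ =>
    exists_forall_eigenvector_eq_smul (μ := μ) (G := G) (fun g => χ (QuotientAddGroup.mk g))
  choose e he hbe using hex
  refine ⟨e, he, fun f => ?_⟩
  obtain ⟨p, hp, hpf, hlim⟩ := UnitaryRep.exists_tendsto_finsetAvg (koopman G μ) θ f
  obtain ⟨b, hb1, hb2, hb3⟩ := UnitaryRep.exists_sum_eigenvectors (koopman G μ) θ.range (b := p)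
    (by rintro _ ⟨g, rfl⟩; exact hp g)
  choose k hk hk' using fun χ => hbe χ (b χ) (hb2 χ)
  refine ⟨k, fun χ => (hk χ).trans ((hb1 χ).trans hpf), fun F hF => ?_⟩
  have h1 : ∑ χ, k χ • e χ = p := by
    rw [← hb3]
    exact Finset.sum_congr rfl fun χ _ => (hk' χ).symm
  rw [h1]
  exact hlim F hF

end Koopman

/-! ### Eigenfunctions are measurable with respect to the Kronecker factor -/

/-- A probability measure invariant under a dense group of rotations is the Haar measure, because
the integral of a continuous function depends continuously on the translation. -/
theorem eq_haarProb_of_denseRange {G K : Type*} [AddCommGroup G] [AddCommGroup K]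
    [TopologicalSpace K] [IsTopologicalAddGroup K] [CompactSpace K] [T2Space K]
    [SecondCountableTopology K] [MeasurableSpace K] [BorelSpace K] (ν : Measure K)
    [IsProbabilityMeasure ν] (b : G →+ K) (hb : DenseRange b)
    (hν : ∀ g, ν.map (fun k => k + b g) = ν) : ν = haarProb K := by
  have hinv : ν.IsAddLeftInvariant := ⟨fun k => by
    have hk : Measurable fun t => k + t := by fun_prop
    have : IsProbabilityMeasure (ν.map fun t => k + t) :=
      Measure.isProbabilityMeasure_map hk.aemeasurable
    refine ext_of_forall_integral_eq_of_IsFiniteMeasure fun f => ?_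
    have hmap : ∀ k, ∫ t, f t ∂(ν.map (fun t => k + t)) = ∫ t, f (k + t) ∂ν := fun k =>
      integral_map (by fun_prop) f.continuous.aestronglyMeasurable
    have hcont : Continuous fun k => ∫ t, f (k + t) ∂ν := by
      refine continuous_of_dominated (bound := fun _ => ‖f‖)
        (fun k => (by fun_prop : Continuous fun t => f (k + t)).aestronglyMeasurable)
        (fun k => Eventually.of_forall fun t => f.norm_coe_le_norm _) (integrable_const _)
        (Eventually.of_forall fun t => by fun_prop)
    have heq : (fun k => ∫ t, f (k + t) ∂ν) = fun _ => ∫ t, f t ∂ν := by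
      refine hb.equalizer hcont continuous_const (funext fun g => ?_)
      have h1 := hν g
      simp only [add_comm _ (b g)] at h1
      simp only [Function.comp_apply]
      rw [← hmap, h1]
    exact (hmap k).trans (congrFun heq k)⟩
  have h1 := Measure.addHaarMeasure_unique ν (⊤ : TopologicalSpace.PositiveCompacts K)
  rw [h1]
  simp [haarProb]

section Kronecker

variable {G X Z : Type*} [AddCommGroup G] [AddAction G X] [MeasurableSpace X]
  [MeasurableConstVAdd G X] {μ : Measure X} [IsProbabilityMeasure μ] [ErgodicVAdd G X μ]
  [AddCommGroup Z] [TopologicalSpace Z] [IsTopologicalAddGroup Z] [CompactSpace Z]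
  [MeasurableSpace Z] [BorelSpace Z] {a : G →+ Z} {π : X → Z}

/-- A measurable map `E` to a compact abelian group that intertwines the action with a rotation is
measurable with respect to the Kronecker factor: by ergodicity it takes its values in a single
coset of the closure of the rotation group, and so is a translate of a compact factor. -/
theorem IsKroneckerFactor.exists_preimage_ae_eq (hπ : IsKroneckerFactor μ a π)
    {T : Type} [AddCommGroup T] [TopologicalSpace T] [IsTopologicalAddGroup T] [CompactSpace T]
    [T2Space T] [SecondCountableTopology T] [MeasurableSpace T] [BorelSpace T] (χ : G →+ T)
    {E : X → T} (hE : Measurable E) (hEχ : ∀ g, ∀ᵐ x ∂μ, E (g +ᵥ x) = E x + χ g) {B : Set T}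
    (hB : MeasurableSet B) : ∃ A : Set Z, MeasurableSet A ∧ E ⁻¹' B =ᵐ[μ] π ⁻¹' A := by
  classical
  set Y : AddSubgroup T := χ.range.topologicalClosure with hY
  have hYc : IsClosed (Y : Set T) := AddSubgroup.isClosed_topologicalClosure _
  have hχY : ∀ g, χ g ∈ Y := fun g => AddSubgroup.le_topologicalClosure _ ⟨g, rfl⟩
  -- the coset of `E x` modulo `Y` is invariant, hence constant
  obtain ⟨c, hc⟩ : ∃ c : T, ∀ᵐ x ∂μ, E x - c ∈ Y := by
    borelize (T ⧸ Y)
    obtain ⟨q, hq⟩ := exists_ae_eq_const_of_forall_vadd G (μ := μ)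
      (f := fun x => (QuotientAddGroup.mk (E x) : T ⧸ Y))
      ((QuotientAddGroup.continuous_mk.measurable.comp hE).nullMeasurable)
      (fun g => by
        filter_upwards [hEχ g] with x hx
        rw [hx]
        refine (QuotientAddGroup.eq.2 ?_).symm
        rw [neg_add_cancel_left]; exact hχY g)
    obtain ⟨c, rfl⟩ := QuotientAddGroup.mk_surjective q
    refine ⟨c, hq.mono fun x hx => ?_⟩
    have h1 := QuotientAddGroup.eq.1 hx.symm
    rwa [neg_add_eq_sub] at h1
  have : CompactSpace Y := isCompact_iff_compactSpace.mp hYc.isCompact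
  let b : G →+ Y := χ.codRestrict Y hχY
  have hb : DenseRange b := by
    intro y
    rw [Topology.IsInducing.subtypeVal.closure_eq_preimage_closure_image]
    have h1 : (Subtype.val '' Set.range b : Set T) = (χ.range : Set T) := by
      rw [← Set.range_comp]; rfl
    have h2 : (y : T) ∈ closure (χ.range : Set T) := y.2
    rw [← h1] at h2
    exact h2
  set S : Set X := {x | E x - c ∈ Y} with hS
  have hSm : MeasurableSet S := (hE.sub_const c) hYc.measurableSet
  let ρ : X → Y := fun x => if h : E x - c ∈ Y then ⟨E x - c, h⟩ else 0
  have hρE : ∀ x, E x - c ∈ Y → (ρ x : T) = E x - c := fun x hx => by simp [ρ, hx]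
  have hρ : Measurable ρ := by
    refine Measurable.subtype_mk (p := fun t => t ∈ Y)
      (f := fun x => if E x - c ∈ Y then E x - c else 0)
      (Measurable.ite hSm (hE.sub_const c) measurable_const)
      (h := fun x => by split_ifs with h; exacts [h, Y.zero_mem]) |> fun h => ?_
    convert! h using 1
    funext x
    refine Subtype.ext ?_
    by_cases hx : E x - c ∈ Y <;> simp [ρ, hx]
  have : SecondCountableTopology Y :=
    TopologicalSpace.Subtype.secondCountableTopology (Y : Set T)
  have hequiv : ∀ g, ∀ᵐ x ∂μ, ρ (g +ᵥ x) = ρ x + b g := by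
    intro g
    filter_upwards [hEχ g, hc, ae_vadd_of_ae g hc] with x h1 h2 h3
    refine Subtype.ext ?_
    rw [hρE _ h3, AddSubgroup.coe_add, hρE _ h2, h1]
    change E x + χ g - c = E x - c + χ g
    abel
  have hprob : IsProbabilityMeasure (μ.map ρ) := Measure.isProbabilityMeasure_map hρ.aemeasurable
  have hfac : IsCompactFactor μ b ρ := by
    refine ⟨⟨hρ, eq_haarProb_of_denseRange _ b hb fun g => ?_⟩, hequiv⟩
    have h1 : (fun x => ρ x + b g) =ᵐ[μ] ρ ∘ (g +ᵥ ·) := (hequiv g).mono fun x hx => hx.symm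
    have hv := measurePreserving_vadd g μ
    rw [Measure.map_map (by fun_prop) hρ]
    change μ.map (fun x => ρ x + b g) = _
    rw [Measure.map_congr h1, ← Measure.map_map hρ hv.measurable, hv.map_eq]
  have hB' : MeasurableSet {y : Y | (y : T) + c ∈ B} :=
    (measurable_subtype_coe.add_const c) hB
  obtain ⟨A, hA, hAe⟩ := hπ.maximal Y b ρ hfac _ hB'
  refine ⟨A, hA, EventuallyEq.trans ?_ hAe⟩
  filter_upwards [hc] with x hx
  refine propext ?_
  change E x ∈ B ↔ (ρ x : T) + c ∈ B
  rw [hρE x hx, sub_add_cancel]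

/-- Eigenfunctions are measurable with respect to the Kronecker factor: up to a constant, the
eigenfunction is a map to the circle that intertwines the action with the rotations given by its
eigenvalues. -/
theorem IsKroneckerFactor.aestronglyMeasurable_eigenvector (hπ : IsKroneckerFactor μ a π)
    {w : Lp ℂ 2 μ} (hw : (koopman G μ).IsEigenvector w) :
    AEStronglyMeasurable[MeasurableSpace.comap π inferInstance] w μ := by
  rcases eq_or_ne w 0 with rfl | hw0
  · exact AEStronglyMeasurable.congr stronglyMeasurable_zero.aestronglyMeasurable
      (Lp.coeFn_zero ℂ 2 μ).symm
  choose c hc using hw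
  have hc1 : ∀ g, ‖c g‖ = 1 := fun g => UnitaryRep.IsEigenvector.norm_eq_one hw0 (hc g)
  have hcadd : ∀ g h, c (g + h) = c g * c h := fun g h => by
    have h1 : c (g + h) • w = (c g * c h) • w := by
      rw [← hc, (koopman G μ).add_apply, hc h, map_smul, hc g, smul_smul, mul_comm]
    exact smul_left_injective ℂ hw0 h1
  let cc : G → Circle := fun g => ⟨c g, mem_sphere_zero_iff_norm.2 (hc1 g)⟩
  have hccadd : ∀ g h, cc (g + h) = cc g * cc h := fun g h => Subtype.ext (hcadd g h)
  let χ : G →+ Additive Circle := AddMonoidHom.mk' (fun g => Additive.ofMul (cc g))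
    fun g h => congrArg Additive.ofMul (hccadd g h)
  borelize (Additive Circle)
  set w' : X → ℂ := (Lp.aestronglyMeasurable w).mk w with hw'
  have hw'm : Measurable w' := (Lp.aestronglyMeasurable w).stronglyMeasurable_mk.measurable
  have hww' : w =ᵐ[μ] w' := (Lp.aestronglyMeasurable w).ae_eq_mk
  let E : X → Additive Circle := fun x => Additive.ofMul (Circle.exp (Complex.arg (w' x)))
  have hE : Measurable E :=
    (continuous_ofMul.comp Circle.exp.continuous).measurable.comp
      (Complex.measurable_arg.comp hw'm)
  let val : Additive Circle → ℂ := fun t => (t.toMul : ℂ)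
  have hval : Continuous val := continuous_subtype_val.comp continuous_toMul
  have hwE : ∀ᵐ x ∂μ, w x = ‖w‖ * val (E x) := by
    have hn := UnitaryRep.IsEigenvector.ae_norm_eq (μ := μ) fun g => ⟨c g, hc g⟩
    filter_upwards [hww', hn] with x h1 h2
    rw [← h2, h1]
    exact (Complex.norm_mul_exp_arg_mul_I (w' x)).symm
  have hEχ : ∀ g, ∀ᵐ x ∂μ, E (g +ᵥ x) = E x + χ g := by
    intro g
    filter_upwards [hwE, ae_vadd_of_ae g hwE, coeFn_koopman μ g w, Lp.coeFn_smul (c g) w]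
      with x h1 h2 h3 h4
    rw [hc, h4, Pi.smul_apply, h1, h2, smul_eq_mul] at h3
    have h5 : (‖w‖ : ℂ) ≠ 0 := by exact_mod_cast norm_ne_zero_iff.2 hw0
    have h6 : val (E (g +ᵥ x)) = val (E x) * c g :=
      mul_left_cancel₀ h5 (by linear_combination -h3)
    exact congrArg Additive.ofMul (Subtype.ext h6 :
      (E (g +ᵥ x)).toMul = (E x).toMul * (χ g).toMul)
  have hset := fun (B : Set (Additive Circle)) (hB : MeasurableSet B) =>
    hπ.exists_preimage_ae_eq χ hE hEχ hB
  -- the preimages under `E` of Borel sets are preimages under `π` only modulo null sets, so `val ∘ E`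
  -- is treated as a limit of simple functions
  have hvalE : AEStronglyMeasurable[MeasurableSpace.comap π inferInstance]
      (fun x => val (E x)) μ := by
    have hsm := hval.stronglyMeasurable
    suffices hn : ∀ n, AEStronglyMeasurable[MeasurableSpace.comap π inferInstance]
        (fun x => hsm.approx n (E x)) μ by
      choose f hf hf' using hn
      refine ⟨fun x => limUnder atTop fun n => f n x, @StronglyMeasurable.limUnder _ _ _
        (MeasurableSpace.comap π inferInstance) _ _ _ _ _ _ _ hf, ?_⟩
      filter_upwards [ae_all_iff.2 hf'] with x hx
      refine ((hsm.tendsto_approx (E x)).congr hx).limUnder_eq.symm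
    intro n
    have h1 : (fun x => hsm.approx n (E x)) = ∑ y ∈ (hsm.approx n).range,
        (E ⁻¹' (hsm.approx n ⁻¹' {y})).indicator fun _ => y := by
      funext x
      rw [Finset.sum_apply, Finset.sum_eq_single_of_mem (hsm.approx n (E x))
        (SimpleFunc.mem_range_self _ _)]
      · simp [Set.indicator]
      · intro y _ hy
        exact Set.indicator_of_notMem (s := E ⁻¹' (hsm.approx n ⁻¹' {y}))
          (fun h => hy (Eq.symm h)) _
    rw [h1]
    refine Finset.sum_induction _
      (fun f => AEStronglyMeasurable[MeasurableSpace.comap π inferInstance] f μ)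
      (fun f g hf hg => hf.add hg) stronglyMeasurable_zero.aestronglyMeasurable fun y _ => ?_
    obtain ⟨A, hA, hAe⟩ := hset _ ((hsm.approx n).measurableSet_fiber y)
    have h2 : MeasurableSet[MeasurableSpace.comap π inferInstance] (π ⁻¹' A) := ⟨A, hA, rfl⟩
    exact AEStronglyMeasurable.congr
      ((stronglyMeasurable_const.indicator h2).aestronglyMeasurable)
      (indicator_ae_eq_of_ae_eq_set hAe.symm)
  exact AEStronglyMeasurable.congr (hvalE.const_mul (‖w‖ : ℂ)) (hwE.mono fun x hx => hx.symm)

/-- A function with zero conditional expectation on the Kronecker factor is weakly mixing, since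
eigenfunctions are measurable with respect to that factor. -/
theorem IsKroneckerFactor.isWeaklyMixing_of_condExp_eq_zero (hπ : IsKroneckerFactor μ a π)
    {f : X → ℂ} (hf : MemLp f 2 μ)
    (hf0 : μ[f | MeasurableSpace.comap π inferInstance] =ᵐ[μ] 0) :
    (koopman G μ).IsWeaklyMixing hf.toLp := by
  intro w hw
  have hm : MeasurableSpace.comap π inferInstance ≤ ‹MeasurableSpace X› :=
    hπ.measurePreserving.measurable.comap_le
  have hwm := hπ.aestronglyMeasurable_eigenvector hw
  have hwm' : AEStronglyMeasurable[MeasurableSpace.comap π inferInstance]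
      (fun x => (starRingEnd ℂ) (w x)) μ :=
    Complex.continuous_conj.comp_aestronglyMeasurable hwm
  have hint : Integrable (fun x => (starRingEnd ℂ) (w x) * f x) μ := by
    have h1 : MemLp (fun x => (starRingEnd ℂ) (w x)) 2 μ :=
      (Lp.memLp w).of_le (hwm'.mono hm) (Eventually.of_forall fun x => by simp)
    exact h1.integrable_mul hf
  have h1 := condExp_bilin_of_aestronglyMeasurable_left (ContinuousLinearMap.mul ℝ ℂ) hwm' hint
    (hf.integrable one_le_two)
  calc (inner ℂ w hf.toLp : ℂ) = ∫ x, (starRingEnd ℂ) (w x) * f x ∂μ := by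
        rw [L2.inner_def]
        refine integral_congr_ae ?_
        filter_upwards [hf.coeFn_toLp] with x hx
        rw [hx, RCLike.inner_apply, mul_comm]
    _ = ∫ x, (μ[fun x => (starRingEnd ℂ) (w x) * f x |
          MeasurableSpace.comap π inferInstance]) x ∂μ := (integral_condExp hm).symm
    _ = ∫ _, (0 : ℂ) ∂μ := by
        refine integral_congr_ae ?_
        filter_upwards [h1, hf0] with x h2 h3
        refine Eq.trans h2 ?_
        rw [h3]; simp
    _ = 0 := by simp

end Kronecker

/-! ### Uniform Cesàro limits in `L²` -/

section UCLim

variable {G X : Type*} [MeasurableSpace X] {μ : Measure X}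
  {u u' : G → X → ℂ} {l l' : X → ℂ}

theorem coeFn_finsetAvg_toLp (hu : ∀ g, MemLp (u g) 2 μ) (s : Finset G) :
    ((finsetAvg s (fun g => (hu g).toLp (u g)) : Lp ℂ 2 μ) : X → ℂ) =ᵐ[μ]
      fun x => (s.card : ℂ)⁻¹ * ∑ g ∈ s, u g x := by
  classical
  have hsum : ∀ t : Finset G, ((∑ g ∈ t, (hu g).toLp (u g) : Lp ℂ 2 μ) : X → ℂ) =ᵐ[μ]
      fun x => ∑ g ∈ t, u g x := by
    intro t
    induction t using Finset.induction_on with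
    | empty => simpa using! Lp.coeFn_zero ℂ 2 μ
    | insert g t hg ih =>
      rw [Finset.sum_insert hg]
      filter_upwards [Lp.coeFn_add ((hu g).toLp (u g)) (∑ g ∈ t, (hu g).toLp (u g) : Lp ℂ 2 μ), ih,
        (hu g).coeFn_toLp] with x h1 h2 h3
      rw [h1, Pi.add_apply, h2, h3, Finset.sum_insert hg]
  obtain ⟨S, hS⟩ : ∃ S : Lp ℂ 2 μ, S = ∑ g ∈ s, (hu g).toLp (u g) := ⟨_, rfl⟩
  have h0 := hsum s
  rw [finsetAvg, ← hS]
  rw [← hS] at h0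
  filter_upwards [Lp.coeFn_smul (s.card : ℝ)⁻¹ S, h0] with x h1 h2
  rw [h1, Pi.smul_apply, h2, Complex.real_smul]
  simp

variable [AddCommGroup G]

/-- A uniform Cesàro limit in terms of the elements of the Hilbert space `L²(μ)`. -/
theorem isUCLimL2_iff (hu : ∀ g, MemLp (u g) 2 μ) (hl : MemLp l 2 μ) :
    IsUCLimL2 μ u l ↔ ∀ F : ℕ → Finset G, IsFolnerSequence F →
      Tendsto (fun N => finsetAvg (F N) (fun g => (hu g).toLp (u g))) atTop (𝓝 (hl.toLp l)) := by
  have key : ∀ F : ℕ → Finset G,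
      Tendsto (fun N => finsetAvg (F N) (fun g => (hu g).toLp (u g))) atTop (𝓝 (hl.toLp l)) ↔
      Tendsto (fun N => eLpNorm (fun x => ((F N).card : ℂ)⁻¹ * (∑ g ∈ F N, u g x) - l x) 2 μ)
        atTop (𝓝 0) := by
    intro F
    rw [Lp.tendsto_Lp_iff_tendsto_eLpNorm]
    refine tendsto_congr fun N => eLpNorm_congr_ae ?_
    filter_upwards [coeFn_finsetAvg_toLp hu (F N)] with x hx
    rw [Pi.sub_apply, hx]
  exact ⟨fun h F hF => (key F).2 (h.tendsto F hF),
    fun h => ⟨hu, hl, fun F hF => (key F).1 (h F hF)⟩⟩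

namespace IsUCLimL2

theorem congr (h : IsUCLimL2 μ u l) (hu : ∀ g, u g =ᵐ[μ] u' g) (hl : l =ᵐ[μ] l') :
    IsUCLimL2 μ u' l' := by
  have hu' : ∀ g, MemLp (u' g) 2 μ := fun g => (h.memLp g).ae_eq (hu g)
  have hl' : MemLp l' 2 μ := h.memLp_lim.ae_eq hl
  rw [isUCLimL2_iff hu' hl']
  intro F hF
  have h1 := (isUCLimL2_iff h.memLp h.memLp_lim).1 h F hF
  rw [MemLp.toLp_congr h.memLp_lim hl' hl] at h1
  refine h1.congr fun N => ?_
  congr 1; ext1 g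
  exact MemLp.toLp_congr _ _ (hu g)

theorem add (h : IsUCLimL2 μ u l) (h' : IsUCLimL2 μ u' l') :
    IsUCLimL2 μ (fun g x => u g x + u' g x) (fun x => l x + l' x) := by
  change IsUCLimL2 μ (fun g => u g + u' g) (l + l')
  rw [isUCLimL2_iff (fun g => (h.memLp g).add (h'.memLp g)) (h.memLp_lim.add h'.memLp_lim)]
  intro F hF
  have h1 := ((isUCLimL2_iff h.memLp h.memLp_lim).1 h F hF).add
    ((isUCLimL2_iff h'.memLp h'.memLp_lim).1 h' F hF)
  rw [← MemLp.toLp_add] at h1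
  refine h1.congr fun N => ?_
  rw [← finsetAvg.add]
  congr 1

/-- Uniform Cesàro limits pass to uniform limits of families. -/
theorem of_approx (hu : ∀ g, MemLp (u g) 2 μ) (hl : MemLp l 2 μ)
    (happ : ∀ ε : ℝ, 0 < ε → ∃ (u' : G → X → ℂ) (l' : X → ℂ), IsUCLimL2 μ u' l' ∧
      (∀ g, eLpNorm (fun x => u g x - u' g x) 2 μ ≤ ENNReal.ofReal ε) ∧
      eLpNorm (fun x => l x - l' x) 2 μ ≤ ENNReal.ofReal ε) :
    IsUCLimL2 μ u l := by
  rw [isUCLimL2_iff hu hl]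
  intro F hF
  rw [Metric.tendsto_nhds]
  intro ε hε
  obtain ⟨u', l', h, hu', hl'⟩ := happ (ε / 3) (by positivity)
  have h1 := (isUCLimL2_iff h.memLp h.memLp_lim).1 h F hF
  filter_upwards [Metric.tendsto_nhds.1 h1 (ε / 3) (by positivity)] with N hN
  have h2 : dist (finsetAvg (F N) fun g => (hu g).toLp (u g))
      (finsetAvg (F N) fun g => (h.memLp g).toLp (u' g)) ≤ ε / 3 := by
    rw [dist_eq_norm, ← finsetAvg.sub]
    refine finsetAvg.norm_le_of_forall_le _ (by positivity) fun g => ?_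
    rw [← MemLp.toLp_sub, Lp.norm_toLp]
    exact ENNReal.toReal_le_of_le_ofReal (by positivity) (hu' g)
  have h3 : dist (h.memLp_lim.toLp l') (hl.toLp l) ≤ ε / 3 := by
    rw [dist_comm, dist_eq_norm, ← MemLp.toLp_sub, Lp.norm_toLp]
    exact ENNReal.toReal_le_of_le_ofReal (by positivity) hl'
  refine (dist_triangle4 _ _ _ _).trans_lt
    (b := dist _ (finsetAvg (F N) fun g => (h.memLp g).toLp (u' g)) +
      dist _ (h.memLp_lim.toLp l') + dist _ _) ?_
  linarith

theorem comp_measurePreserving {Y : Type*} [MeasurableSpace Y] {ν : Measure Y} {π : Y → X}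
    (h : IsUCLimL2 μ u l) (hπ : MeasurePreserving π ν μ) :
    IsUCLimL2 ν (fun g y => u g (π y)) (fun y => l (π y)) where
  memLp g := (h.memLp g).comp_measurePreserving hπ
  memLp_lim := h.memLp_lim.comp_measurePreserving hπ
  tendsto F hF := by
    refine (h.tendsto F hF).congr fun N => ?_
    have hm : AEStronglyMeasurable
        (fun x => ((F N).card : ℂ)⁻¹ * (∑ g ∈ F N, u g x) - l x) μ := by
      refine ((Finset.aestronglyMeasurable_fun_sum _ fun g _ =>
        (h.memLp g).aestronglyMeasurable).const_mul _).sub h.memLp_lim.aestronglyMeasurable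
    exact (eLpNorm_comp_measurePreserving hm hπ).symm

end IsUCLimL2

end UCLim

/-! ### Weakly mixing functions in double averages -/

section DoubleAverage

variable {G X : Type*} [AddCommGroup G] [AddAction G X] [MeasurableSpace X]
  [MeasurableConstVAdd G X] {μ : Measure X}

theorem inner_toLp_toLp {f g : X → ℂ} (hf : MemLp f 2 μ) (hg : MemLp g 2 μ) :
    (inner ℂ hf.toLp hg.toLp : ℂ) = ∫ x, (starRingEnd ℂ) (f x) * g x ∂μ := by
  rw [L2.inner_def]
  refine integral_congr_ae ?_
  filter_upwards [hf.coeFn_toLp, hg.coeFn_toLp] with x h1 h2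
  rw [h1, h2, RCLike.inner_apply, mul_comm]

theorem memLp_two_mul {f g : X → ℂ} (hf : MemLp f ∞ μ) (hg : MemLp g 2 μ) :
    MemLp (fun x => f x * g x) 2 μ :=
  hg.mul hf

theorem MeasureTheory.MemLp.vadd [VAddInvariantMeasure G X μ] {f : X → ℂ} {p : ℝ≥0∞}
    (hf : MemLp f p μ) (g : G) : MemLp (fun x => f (g +ᵥ x)) p μ :=
  hf.comp_measurePreserving (measurePreserving_vadd g μ)

theorem exists_ae_norm_le {f : X → ℂ} (hf : MemLp f ∞ μ) :
    ∃ C : ℝ, 0 ≤ C ∧ ∀ᵐ x ∂μ, ‖f x‖ ≤ C :=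
  ⟨lpNorm f ∞ μ, lpNorm_nonneg, ae_le_lpNorm_exponent_top hf⟩

variable [IsProbabilityMeasure μ]

theorem memLp_two_of_top {f : X → ℂ} (hf : MemLp f ∞ μ) : MemLp f 2 μ :=
  hf.mono_exponent le_top

theorem norm_toLp_le {f : X → ℂ} (hf : MemLp f 2 μ) {C : ℝ} (hC : 0 ≤ C)
    (h : ∀ᵐ x ∂μ, ‖f x‖ ≤ C) : ‖hf.toLp‖ ≤ C := by
  have h1 := Lp.norm_le_of_ae_bound (f := hf.toLp) hC (by
    filter_upwards [hf.coeFn_toLp, h] with x h1 h2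
    rwa [h1])
  simpa [measureUnivNNReal] using h1

variable [ErgodicVAdd G X μ]

theorem memLp_two_mul_vadd {f₁ f₂ : X → ℂ} (hf₁ : MemLp f₁ ∞ μ) (hf₂ : MemLp f₂ ∞ μ)
    (g h : G) : MemLp (fun x => f₁ (g +ᵥ x) * f₂ (h +ᵥ x)) 2 μ :=
  memLp_two_mul (hf₁.vadd g) (memLp_two_of_top (hf₂.vadd h))

/-- Double averages of `f₁` and `f₂` vanish if `f₁` is weakly mixing. This follows from the van der
Corput lemma: the correlations are computed by the mean ergodic theorem along `ψ - φ`, and tend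
to `0` in mean because `f₁` is mixing in mean along `φ`. -/
theorem isUCLimL2_zero_of_isWeaklyMixing_left (φ ψ : G →+ G) [φ.range.FiniteIndex]
    [(ψ - φ).range.FiniteIndex] {f₁ f₂ : X → ℂ} (hf₁ : MemLp f₁ ∞ μ) (hf₂ : MemLp f₂ ∞ μ)
    (hmix : (koopman G μ).IsWeaklyMixing (memLp_two_of_top hf₁).toLp) :
    IsUCLimL2 μ (fun (g : G) x => f₁ (φ g +ᵥ x) * f₂ (ψ g +ᵥ x)) (fun _ => 0) := by
  have hu := fun g : G => memLp_two_mul_vadd hf₁ hf₂ (φ g) (ψ g)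
  rw [isUCLimL2_iff hu (MemLp.zero' (ε := ℂ))]
  intro F hF
  obtain ⟨C₁, hC₁, hb₁⟩ := exists_ae_norm_le hf₁
  obtain ⟨C₂, hC₂, hb₂⟩ := exists_ae_norm_le hf₂
  have hbound : ∀ g, ‖(hu g).toLp‖ ≤ C₁ * C₂ := fun g => by
    refine norm_toLp_le _ (by positivity) ?_
    filter_upwards [ae_vadd_of_ae (φ g) hb₁, ae_vadd_of_ae (ψ g) hb₂] with x h1 h2
    rw [norm_mul]; gcongr
  -- the functions `x ↦ f₁ (φ h + x) * conj (f₁ x)` and `x ↦ conj (f₂ (ψ h + x)) * f₂ x`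
  have hA : ∀ h : G, MemLp (fun x => f₁ (φ h +ᵥ x) * (starRingEnd ℂ) (f₁ x)) 2 μ := fun h =>
    memLp_two_mul (hf₁.vadd _) (memLp_two_of_top hf₁.star)
  have hB : ∀ h : G, MemLp (fun x => (starRingEnd ℂ) (f₂ (ψ h +ᵥ x)) * f₂ x) 2 μ := fun h =>
    memLp_two_mul (hf₂.vadd _).star (memLp_two_of_top hf₂)
  have hBnorm : ∀ h, ‖(hB h).toLp‖ ≤ C₂ * C₂ := fun h => by
    refine norm_toLp_le _ (by positivity) ?_
    filter_upwards [ae_vadd_of_ae (ψ h) hb₂, hb₂] with x h1 h2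
    rw [norm_mul, RCLike.norm_conj]; gcongr
  -- substituting `x - φ g` for `x` makes the correlation depend on `g` through `(ψ - φ) g` only
  have hcorr : ∀ h g, (inner ℂ (hu (g + h)).toLp (hu g).toLp : ℂ) =
      inner ℂ (hA h).toLp (koopman G μ ((ψ - φ) g) (hB h).toLp) := by
    intro h g
    have h1 : koopman G μ ((ψ - φ) g) (hB h).toLp = ((hB h).vadd ((ψ - φ) g)).toLp :=
      Lp.toLp_compMeasurePreserving (hB h) (measurePreserving_vadd _ μ)
    rw [h1, inner_toLp_toLp, inner_toLp_toLp]
    refine Eq.trans ?_ ((measurePreserving_vadd (φ g) μ).integral_comp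
      (measurableEmbedding_const_vadd (φ g)) _)
    refine integral_congr_ae (Eventually.of_forall fun x => ?_)
    simp only [map_add, vadd_vadd, map_mul, Complex.conj_conj, AddMonoidHom.sub_apply,
      sub_add_cancel]
    rw [add_comm (φ g), add_comm (ψ g)]
    ring
  obtain ⟨e, he, hlim⟩ := exists_forall_tendsto_koopman (μ := μ) (ψ - φ)
  choose k hk hklim using fun h => hlim (hB h).toLp
  refine hF.tendsto_finsetAvg_zero_of_correlation hbound
    (Γ := fun h => inner ℂ (hA h).toLp (∑ i, k h i • e i)) (fun h => ?_) (fun F' hF' => ?_)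
  · have h1 : Tendsto (fun N => (inner ℂ (hA h).toLp
        (finsetAvg (F N) fun g => koopman G μ ((ψ - φ) g) (hB h).toLp) : ℂ)) atTop
        (𝓝 (inner ℂ (hA h).toLp (∑ i, k h i • e i))) :=
      tendsto_const_nhds.inner (hklim h F hF)
    refine h1.congr fun N => ?_
    refine (inner_finsetAvg_right _ _ _).trans ?_
    congr 1; ext g
    exact (hcorr h g).symm
  · have hfe : ∀ i, MemLp (fun x => f₁ x * e i x) 2 μ := fun i =>
      memLp_two_mul hf₁ (memLp_two_of_top (he i))
    have hAe : ∀ h i, (inner ℂ (hA h).toLp (e i) : ℂ) =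
        inner ℂ (koopman G μ (φ h) (memLp_two_of_top hf₁).toLp) (hfe i).toLp := by
      intro h i
      have h1 : koopman G μ (φ h) (memLp_two_of_top hf₁).toLp =
          ((memLp_two_of_top hf₁).vadd (φ h)).toLp :=
        Lp.toLp_compMeasurePreserving _ (measurePreserving_vadd _ μ)
      have h2 : e i = (Lp.memLp (e i)).toLp := (Lp.toLp_coeFn _ _).symm
      conv_lhs => rw [h2]
      rw [h1, inner_toLp_toLp, inner_toLp_toLp]
      refine integral_congr_ae (Eventually.of_forall fun x => ?_)
      simp only [map_mul, Complex.conj_conj]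
      ring
    have hsum : Tendsto (fun N => C₂ * C₂ * ∑ i, finsetAvg (F' N) (fun h =>
        ‖(inner ℂ (koopman G μ (φ h) (memLp_two_of_top hf₁).toLp) (hfe i).toLp : ℂ)‖)) atTop
        (𝓝 0) := by
      have := (tendsto_finsetSum Finset.univ fun i _ =>
        hmix.tendsto_finsetAvg_norm_inner φ (hfe i).toLp hF').const_mul (C₂ * C₂)
      simpa using this
    refine squeeze_zero (fun N => finsetAvg.nonneg _ fun _ => norm_nonneg _) (fun N => ?_) hsum
    rw [← finsetAvg.sum, ← smul_eq_mul, ← finsetAvg.smul]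
    refine finsetAvg.mono _ fun h => ?_
    rw [inner_sum, smul_eq_mul, Finset.mul_sum]
    refine (norm_sum_le _ _).trans (Finset.sum_le_sum fun i _ => ?_)
    rw [inner_smul_right, norm_mul, hAe]
    gcongr
    exact (hk h i).trans (hBnorm h)

/-- The symmetric statement, for `f₂` weakly mixing. -/
theorem isUCLimL2_zero_of_isWeaklyMixing_right (φ ψ : G →+ G) [ψ.range.FiniteIndex]
    [(ψ - φ).range.FiniteIndex] {f₁ f₂ : X → ℂ} (hf₁ : MemLp f₁ ∞ μ) (hf₂ : MemLp f₂ ∞ μ)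
    (hmix : (koopman G μ).IsWeaklyMixing (memLp_two_of_top hf₂).toLp) :
    IsUCLimL2 μ (fun (g : G) x => f₁ (φ g +ᵥ x) * f₂ (ψ g +ᵥ x)) (fun _ => 0) := by
  have h1 : (φ - ψ).range = (ψ - φ).range := by
    ext x
    constructor
    · rintro ⟨g, rfl⟩; exact ⟨-g, by simp [neg_add_eq_sub]⟩
    · rintro ⟨g, rfl⟩; exact ⟨-g, by simp [neg_add_eq_sub]⟩
  have : (φ - ψ).range.FiniteIndex := h1 ▸ inferInstance
  simpa only [mul_comm] using isUCLimL2_zero_of_isWeaklyMixing_left ψ φ hf₂ hf₁ hmix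

end DoubleAverage

/-- A factor is characteristic for an admissible pair as soon as the functions with zero conditional
expectation on it are weakly mixing. -/
theorem isCharacteristicFactor_of_isWeaklyMixing {G X : Type*} [AddCommGroup G] [AddAction G X]
    (m : MeasurableSpace X) [m₀ : MeasurableSpace X] [MeasurableConstVAdd G X] {μ : Measure X}
    [IsProbabilityMeasure μ] [ErgodicVAdd G X μ] (hm : m ≤ m₀)
    (hmix : ∀ (f : X → ℂ) (hf : MemLp f 2 μ), μ[f | m] =ᵐ[μ] 0 →
      (koopman G μ).IsWeaklyMixing hf.toLp)
    {φ ψ : G →+ G} (hφψ : IsAdmissiblePair φ ψ) : IsCharacteristicFactor m μ φ ψ := by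
  intro f₁ f₂ hf₁ hf₂
  have := hφψ.finiteIndex_left
  have := hφψ.finiteIndex_right
  have := hφψ.finiteIndex_sub
  have hmix' : ∀ {f : X → ℂ} (_ : MemLp f ∞ μ) (hsub : MemLp (fun x => f x - (μ[f|m]) x) ∞ μ),
      (koopman G μ).IsWeaklyMixing (memLp_two_of_top hsub).toLp := by
    intro f hf hsub
    refine hmix _ _ ?_
    have hi : Integrable f μ := (memLp_two_of_top hf).integrable one_le_two
    have h1 := condExp_sub hi integrable_condExp m (g := μ[f|m])
    have h2 := condExp_condExp_of_le (μ := μ) (f := f) le_rfl hm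
    filter_upwards [h1, h2] with x h3 h4
    refine Eq.trans h3 ?_
    rw [Pi.sub_apply, h4, sub_self, Pi.zero_apply]
  have hE₁ : MemLp (μ[f₁|m]) ∞ μ := hf₁.condExp le_top
  have hE₂ : MemLp (μ[f₂|m]) ∞ μ := hf₂.condExp le_top
  have hD₁ : MemLp (fun x => f₁ x - (μ[f₁|m]) x) ∞ μ := hf₁.sub hE₁
  have hD₂ : MemLp (fun x => f₂ x - (μ[f₂|m]) x) ∞ μ := hf₂.sub hE₂
  have h1 := isUCLimL2_zero_of_isWeaklyMixing_left φ ψ hD₁ hf₂ (hmix' hf₁ hD₁)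
  have h2 := isUCLimL2_zero_of_isWeaklyMixing_right φ ψ hE₁ hD₂ (hmix' hf₂ hD₂)
  refine (h1.add h2).congr (fun g => Eventually.of_forall fun x => ?_)
    (Eventually.of_forall fun x => add_zero 0)
  simp only
  ring

theorem IsKroneckerFactor.isCharacteristicFactor {G X Z : Type*} [AddCommGroup G] [AddAction G X]
    [MeasurableSpace X] [MeasurableConstVAdd G X] {μ : Measure X} [IsProbabilityMeasure μ]
    [ErgodicVAdd G X μ] [AddCommGroup Z] [TopologicalSpace Z] [IsTopologicalAddGroup Z]
    [CompactSpace Z] [MeasurableSpace Z] [BorelSpace Z] {a : G →+ Z} {π : X → Z}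
    (hπ : IsKroneckerFactor μ a π) {φ ψ : G →+ G} (hφψ : IsAdmissiblePair φ ψ) :
    IsCharacteristicFactor (MeasurableSpace.comap π inferInstance) μ φ ψ :=
  isCharacteristicFactor_of_isWeaklyMixing _ hπ.measurePreserving.measurable.comap_le
    (fun _ hf hf0 => hπ.isWeaklyMixing_of_condExp_eq_zero hf hf0) hφψ

/-! ### Double averages on a compact group rotation -/

instance haarProb.instIsAddHaarMeasure (K : Type*) [AddCommGroup K] [TopologicalSpace K]
    [IsTopologicalAddGroup K] [CompactSpace K] [MeasurableSpace K] [BorelSpace K] :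
    (haarProb K).IsAddHaarMeasure :=
  inferInstanceAs (Measure.addHaarMeasure _).IsAddHaarMeasure

/-- Equidistribution of a dense subgroup along Følner sequences. The averages of the translates of
`f` by the group elements have asymptotically the same value at all points, and `∫ f` is the mean
of these values. -/
theorem IsFolnerSequence.tendsto_finsetAvg_integral_haarProb {G K : Type*} [AddCommGroup G]
    [AddCommGroup K] [TopologicalSpace K] [IsTopologicalAddGroup K] [CompactSpace K]
    [MeasurableSpace K] [BorelSpace K] {F : ℕ → Finset G} (hF : IsFolnerSequence F) (b : G →+ K)
    (hb : DenseRange b) (f : C(K, ℂ)) :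
    Tendsto (fun N => finsetAvg (F N) (fun g => f (b g))) atTop (𝓝 (∫ k, f k ∂haarProb K)) := by
  set A : ℕ → K → ℂ := fun N k => finsetAvg (F N) (fun g => f (k + b g)) with hA
  have hpt : ∀ k, Tendsto (fun N => A N k - A N 0) atTop (𝓝 0) := by
    intro k
    rw [Metric.tendsto_nhds]
    intro ε hε
    -- choose `h` such that `b h` is so close to `k` that translation by `k` and by `b h` agree
    let T : C(K, C(K, ℂ)) := ContinuousMap.curry ⟨fun q : K × K => f (q.1 + q.2), by fun_prop⟩
    have hnhds : {k' | dist (T k') (T k) < ε / 2} ∈ 𝓝 k :=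
      (T.continuous.tendsto k).eventually (Metric.ball_mem_nhds _ (half_pos hε))
    obtain ⟨h, hh⟩ := hb.exists_mem_open isOpen_interior ⟨k, mem_interior_iff_mem_nhds.2 hnhds⟩
    have hclose : ∀ N, ‖A N k - A N (b h)‖ ≤ ε / 2 := fun N => by
      simp only [hA]
      rw [← finsetAvg.sub]
      refine finsetAvg.norm_le_of_forall_le _ (half_pos hε).le fun g => ?_
      have h0 := interior_subset hh
      have h1 : dist (T (b h)) (T k) < ε / 2 := h0
      have h2 := (ContinuousMap.dist_apply_le_dist (f := T (b h)) (g := T k) (b g)).trans h1.le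
      rw [dist_comm, dist_eq_norm] at h2
      exact h2
    have hshift := hF.tendsto_finsetAvg_add_sub (v := fun g => f (b g)) (C := ‖f‖)
      (fun g => f.norm_coe_le_norm _) h
    filter_upwards [Metric.tendsto_nhds.1 hshift (ε / 2) (half_pos hε)] with N hN
    rw [dist_zero_right] at hN ⊢
    have h3 : A N (b h) - A N 0 =
        finsetAvg (F N) (fun g => f (b (g + h))) - finsetAvg (F N) (fun g => f (b g)) := by
      simp only [hA, zero_add, add_comm (b h), (b.map_add · h)]
    rw [← h3] at hN
    calc ‖A N k - A N 0‖ = ‖(A N k - A N (b h)) + (A N (b h) - A N 0)‖ := by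
          rw [sub_add_sub_cancel]
      _ ≤ _ := norm_add_le _ _
      _ < ε := by linarith [hclose N]
  have hAc : ∀ N, Continuous (A N) := fun N => by
    simp only [hA, finsetAvg]
    fun_prop
  have hAb : ∀ N k, ‖A N k‖ ≤ ‖f‖ := fun N k =>
    finsetAvg.norm_le_of_forall_le _ (norm_nonneg f) fun g => f.norm_coe_le_norm _
  have hcint : ∀ {φ : K → ℂ}, Continuous φ → Integrable φ (haarProb K) := fun {φ} hφ =>
    hφ.integrable_of_hasCompactSupport (HasCompactSupport.of_compactSpace φ)
  have hint : ∀ N, ∫ k, (A N k - A N 0) ∂haarProb K = ∫ k, f k ∂haarProb K - A N 0 := by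
    intro N
    rw [integral_sub (hcint (hAc N)) (integrable_const _), integral_const]
    simp only [probReal_univ, one_smul]
    congr 1
    simp only [hA, finsetAvg]
    rw [integral_smul, integral_finsetSum _ fun g _ => hcint (by fun_prop)]
    simp only [integral_add_right_eq_self fun k => f k]
    exact finsetAvg.const (hF.nonempty N) (∫ k, f k ∂haarProb K)
  have hlim := tendsto_integral_of_dominated_convergence (μ := haarProb K)
    (F := fun N k => A N k - A N 0) (f := fun _ => 0) (fun _ => ‖f‖ + ‖f‖)
    (fun N => (hcint ((hAc N).sub continuous_const)).aestronglyMeasurable) (integrable_const _)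
    (fun N => Eventually.of_forall fun k =>
      (norm_sub_le _ _).trans (add_le_add (hAb N k) (hAb N 0)))
    (Eventually.of_forall hpt)
  simp only [hint, integral_zero] at hlim
  have h1 := (tendsto_const_nhds (x := ∫ k, f k ∂haarProb K)).sub hlim
  simp only [sub_sub_cancel, sub_zero] at h1
  simpa only [hA, zero_add] using h1

theorem memLp_mul_of_bounded {Y : Type*} [MeasurableSpace Y] {μ : Measure Y} [IsFiniteMeasure μ]
    {f g : Y → ℂ} {C₁ C₂ : ℝ} (hf : Measurable f) (hg : Measurable g) (hC₁ : ∀ y, ‖f y‖ ≤ C₁)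
    (hC₂ : ∀ y, ‖g y‖ ≤ C₂) (p : ℝ≥0∞) : MemLp (fun y => f y * g y) p μ := by
  refine MemLp.of_bound (hf.mul hg).aestronglyMeasurable (C₁ * C₂)
    (Eventually.of_forall fun y => ?_)
  rw [norm_mul]
  exact mul_le_mul (hC₁ _) (hC₂ _) (norm_nonneg _) ((norm_nonneg _).trans (hC₁ y))

theorem eLpNorm_two_sq {Y : Type*} [MeasurableSpace Y] (μ : Measure Y) (f : Y → ℂ) :
    eLpNorm f 2 μ ^ 2 = ∫⁻ x, ‖f x‖ₑ ^ 2 ∂μ := by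
  simpa using eLpNorm_nnreal_pow_eq_lintegral (μ := μ) (f := f) (p := 2) two_ne_zero

section Translates

variable {Z W : Type*} [AddCommGroup Z] [TopologicalSpace Z] [IsTopologicalAddGroup Z]
  [CompactSpace Z] [SecondCountableTopology Z] [MeasurableSpace Z] [BorelSpace Z]
  [MeasurableSpace W] {ν : Measure W} [IsProbabilityMeasure ν] {p : W → Z}

/-- Averaging over random translates, of whatever distribution, preserves Haar measure. -/
theorem lintegral_lintegral_add_haarProb (hp : Measurable p) {f : Z → ℝ≥0∞} (hf : Measurable f) :
    ∫⁻ z, ∫⁻ w, f (z + p w) ∂ν ∂haarProb Z = ∫⁻ z, f z ∂haarProb Z := by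
  rw [lintegral_lintegral_swap (by unfold Function.uncurry; fun_prop)]
  simp [lintegral_add_right_eq_self]

theorem ae_ae_add_haarProb (hp : Measurable p) {P : Z → Prop} (h : ∀ᵐ z ∂haarProb Z, P z) :
    ∀ᵐ z ∂haarProb Z, ∀ᵐ w ∂ν, P (z + p w) := by
  set s := toMeasurable (haarProb Z) {z | ¬ P z} with hs
  have hsm : MeasurableSet s := measurableSet_toMeasurable _ _
  have hs0 : haarProb Z s = 0 := (measure_toMeasurable _).trans h
  have h1 := lintegral_lintegral_add_haarProb (ν := ν) hp
    (measurable_const.indicator hsm : Measurable (s.indicator fun _ => (1 : ℝ≥0∞)))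
  rw [lintegral_indicator_const hsm, hs0, mul_zero, lintegral_eq_zero_iff
    (Measurable.lintegral_prod_right' (f := fun q : Z × W => s.indicator (fun _ => 1) (q.1 + p q.2))
      ((measurable_const.indicator hsm).comp (by fun_prop)))] at h1
  filter_upwards [h1] with z hz
  have hm : Measurable fun w => s.indicator (fun _ => (1 : ℝ≥0∞)) (z + p w) :=
    (measurable_const.indicator hsm).comp (by fun_prop)
  have hz' := (lintegral_eq_zero_iff hm).1 hz
  filter_upwards [hz'] with w hw
  by_contra hP
  have : z + p w ∈ s := subset_toMeasurable _ _ hP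
  simp [this] at hw

/-- Averaging over translates does not increase the `L²` norm. -/
theorem eLpNorm_integral_le_of_le_translate (hp : Measurable p) {d : Z → ℂ} (hd : Measurable d)
    {k : Z → W → ℂ} {C : ℝ} (hC : 0 ≤ C) (hk : ∀ z w, ‖k z w‖ ≤ C * ‖d (z + p w)‖) :
    eLpNorm (fun z => ∫ w, k z w ∂ν) 2 (haarProb Z) ≤
      ENNReal.ofReal C * eLpNorm d 2 (haarProb Z) := by
  have htr := lintegral_lintegral_add_haarProb (ν := ν) hp (f := fun z => ‖d z‖ₑ ^ 2) (by fun_prop)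
  rw [← ENNReal.pow_le_pow_left_iff two_ne_zero, eLpNorm_two_sq, mul_pow, eLpNorm_two_sq, ← htr,
    ← lintegral_const_mul]
  swap
  · exact Measurable.lintegral_prod_right' (f := fun q : Z × W => ‖d (q.1 + p q.2)‖ₑ ^ 2)
      (by fun_prop)
  refine lintegral_mono fun z => ?_
  have hdz : AEStronglyMeasurable (fun w => d (z + p w)) ν :=
    (by fun_prop : Measurable fun w => d (z + p w)).aestronglyMeasurable
  have h1 : ‖∫ w, k z w ∂ν‖ₑ ≤ ENNReal.ofReal C * ∫⁻ w, ‖d (z + p w)‖ₑ ∂ν := by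
    rw [← lintegral_const_mul _ (by fun_prop)]
    refine (enorm_integral_le_lintegral_enorm _).trans (lintegral_mono fun w => ?_)
    rw [← ofReal_norm, ← ofReal_norm, ← ENNReal.ofReal_mul hC]
    exact ENNReal.ofReal_le_ofReal (hk z w)
  have h2 : (∫⁻ w, ‖d (z + p w)‖ₑ ∂ν) ^ 2 ≤ ∫⁻ w, ‖d (z + p w)‖ₑ ^ 2 ∂ν := by
    have h3 := eLpNorm_two_sq ν fun w => d (z + p w)
    rw [← h3, ← eLpNorm_one_eq_lintegral_enorm]
    gcongr
    exact eLpNorm_le_eLpNorm_of_exponent_le one_le_two hdz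
  calc _ ≤ (ENNReal.ofReal C * ∫⁻ w, ‖d (z + p w)‖ₑ ∂ν) ^ 2 := by gcongr
    _ ≤ _ := by rw [mul_pow]; gcongr

section Approximation

variable {G : Type*} [AddCommGroup G] {s t : G → Z} {q : W → Z} {h₁ h₂ : Z → ℂ} {C₁ C₂ : ℝ}

theorem memLp_integral_mul_add (hp : Measurable p) (hq : Measurable q) (hm₁ : Measurable h₁)
    (hm₂ : Measurable h₂) (hC₁ : ∀ z, ‖h₁ z‖ ≤ C₁) (hC₂ : ∀ z, ‖h₂ z‖ ≤ C₂) :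
    MemLp (fun z => ∫ w, h₁ (z + p w) * h₂ (z + q w) ∂ν) 2 (haarProb Z) := by
  refine MemLp.of_bound (C := C₁ * C₂) ?_ (Eventually.of_forall fun z => ?_)
  · exact (StronglyMeasurable.integral_prod_right' (ν := ν)
      (f := fun v : Z × W => h₁ (v.1 + p v.2) * h₂ (v.1 + q v.2))
      (by fun_prop : Measurable _).stronglyMeasurable).aestronglyMeasurable
  · refine (norm_integral_le_of_norm_le_const (C := C₁ * C₂)
      (Eventually.of_forall fun w => ?_)).trans (by simp)
    rw [norm_mul]
    exact mul_le_mul (hC₁ _) (hC₂ _) (norm_nonneg _) ((norm_nonneg _).trans (hC₁ 0))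

/-- Approximation of the first function in `L²` by continuous ones: both the averages and the
candidate for the limit depend on it continuously for the `L²` norm, as the second function is
bounded. -/
theorem isUCLimL2_of_forall_continuous [T2Space Z] (hp : Measurable p) (hq : Measurable q)
    (hm₁ : Measurable h₁) (hm₂ : Measurable h₂) (hC₁ : ∀ z, ‖h₁ z‖ ≤ C₁) (hC₂ : ∀ z, ‖h₂ z‖ ≤ C₂)
    (H : ∀ c : C(Z, ℂ), IsUCLimL2 (haarProb Z) (fun (g : G) z => c (z + s g) * h₂ (z + t g))
      (fun z => ∫ w, c (z + p w) * h₂ (z + q w) ∂ν)) :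
    IsUCLimL2 (haarProb Z) (fun (g : G) z => h₁ (z + s g) * h₂ (z + t g))
      (fun z => ∫ w, h₁ (z + p w) * h₂ (z + q w) ∂ν) := by
  have hC₂0 : 0 ≤ C₂ := (norm_nonneg _).trans (hC₂ 0)
  have hmem₁ : MemLp h₁ 2 (haarProb Z) :=
    MemLp.of_bound hm₁.aestronglyMeasurable C₁ (Eventually.of_forall hC₁)
  refine IsUCLimL2.of_approx (fun g => ?_) (memLp_integral_mul_add hp hq hm₁ hm₂ hC₁ hC₂)
    fun ε hε => ?_
  · exact memLp_mul_of_bounded (by fun_prop) (by fun_prop) (fun _ => hC₁ _) (fun _ => hC₂ _) 2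
  obtain ⟨c, hc, -⟩ := hmem₁.exists_boundedContinuous_eLpNorm_sub_le ENNReal.ofNat_ne_top
    (ε := ENNReal.ofReal (ε / (C₂ + 1))) (by positivity)
  have hle : ENNReal.ofReal C₂ * eLpNorm (fun z => h₁ z - c z) 2 (haarProb Z) ≤
      ENNReal.ofReal ε := by
    refine (mul_le_mul_right hc _).trans ?_
    rw [← ENNReal.ofReal_mul hC₂0]
    refine ENNReal.ofReal_le_ofReal ?_
    rw [mul_div_assoc', div_le_iff₀ (by positivity)]
    nlinarith
  have hcm : Measurable c := c.continuous.measurable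
  have hd : Measurable fun z => h₁ z - c z := hm₁.sub hcm
  refine ⟨_, _, H c.toContinuousMap, fun g => le_trans ?_ hle, le_trans ?_ hle⟩
  · have h1 := eLpNorm_comp_measurePreserving (p := 2) hd.aestronglyMeasurable
      (measurePreserving_add_right (haarProb Z) (s g))
    rw [← h1]
    refine eLpNorm_le_mul_eLpNorm_of_ae_le_mul (Eventually.of_forall fun z => ?_) 2
    rw [BoundedContinuousFunction.coe_toContinuousMap, ← sub_mul, norm_mul, mul_comm]
    exact mul_le_mul_of_nonneg_right (hC₂ _) (norm_nonneg _)
  · have h1 : (fun z => (∫ w, h₁ (z + p w) * h₂ (z + q w) ∂ν) -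
        ∫ w, c.toContinuousMap (z + p w) * h₂ (z + q w) ∂ν) =
        fun z => ∫ w, (h₁ (z + p w) - c (z + p w)) * h₂ (z + q w) ∂ν := by
      funext z
      simp only [sub_mul]
      refine (integral_sub (memLp_one_iff_integrable.1 ?_) (memLp_one_iff_integrable.1 ?_)).symm
      · exact memLp_mul_of_bounded (by fun_prop) (by fun_prop) (fun _ => hC₁ _) (fun _ => hC₂ _) 1
      · exact memLp_mul_of_bounded (by fun_prop) (by fun_prop) (fun _ => c.norm_coe_le_norm _)
          (fun _ => hC₂ _) 1
    rw [h1]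
    refine eLpNorm_integral_le_of_le_translate hp hd hC₂0 fun z w => ?_
    rw [norm_mul, mul_comm]
    exact mul_le_mul_of_nonneg_right (hC₂ _) (norm_nonneg _)

end Approximation

end Translates

section Rotation

variable {G Z : Type*} [AddCommGroup G] [AddCommGroup Z] [TopologicalSpace Z]
  [IsTopologicalAddGroup Z] [CompactSpace Z] [SecondCountableTopology Z] [MeasurableSpace Z]
  [BorelSpace Z] (a : G →+ Z) (φ ψ : G →+ G)

instance pairMeasure.instIsProbabilityMeasure : IsProbabilityMeasure (pairMeasure a φ ψ) :=
  Measure.isProbabilityMeasure_map measurable_subtype_coe.aemeasurable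

/-- The orbit of `0` under `(a ∘ φ, a ∘ ψ)` is equidistributed in `Z_{φ,ψ}`. -/
theorem IsFolnerSequence.tendsto_finsetAvg_integral_pairMeasure {F : ℕ → Finset G}
    (hF : IsFolnerSequence F) {f : Z × Z → ℂ} (hf : Continuous f) :
    Tendsto (fun N => finsetAvg (F N) (fun g => f (a (φ g), a (ψ g)))) atTop
      (𝓝 (∫ w, f w ∂pairMeasure a φ ψ)) := by
  let b : G →+ pairSubgroup a φ ψ := ((a.comp φ).prod (a.comp ψ)).codRestrict
    (pairSubgroup a φ ψ) fun g => AddSubgroup.le_topologicalClosure _ ⟨g, rfl⟩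
  have hb : DenseRange b := by
    intro y
    rw [Topology.IsEmbedding.subtypeVal.closure_eq_preimage_closure_image]
    have : Subtype.val '' Set.range b =
        (((a.comp φ).prod (a.comp ψ)).range : Set (Z × Z)) := by
      rw [← Set.range_comp]; rfl
    rw [Set.mem_preimage, this]
    exact y.2
  have h := hF.tendsto_finsetAvg_integral_haarProb b hb
    ⟨fun y => f y.1, hf.comp continuous_subtype_val⟩
  rw [pairMeasure, integral_map measurable_subtype_coe.aemeasurable hf.aestronglyMeasurable]
  exact h

/-- For continuous functions on `Z` the double averages converge at every point. -/
theorem isUCLimL2_of_continuous (c₁ c₂ : C(Z, ℂ)) :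
    IsUCLimL2 (haarProb Z) (fun (g : G) z => c₁ (z + a (φ g)) * c₂ (z + a (ψ g)))
      (fun z => ∫ w, c₁ (z + w.1) * c₂ (z + w.2) ∂pairMeasure a φ ψ) := by
  have hB : ∀ z w : Z, ‖c₁ z * c₂ w‖ ≤ ‖c₁‖ * ‖c₂‖ := fun z w => by
    rw [norm_mul]
    gcongr
    exacts [c₁.norm_coe_le_norm z, c₂.norm_coe_le_norm w]
  have hlc : Continuous fun z => ∫ w, c₁ (z + w.1) * c₂ (z + w.2) ∂pairMeasure a φ ψ :=
    continuous_of_dominated (bound := fun _ => ‖c₁‖ * ‖c₂‖)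
      (fun z => (by fun_prop :
        Continuous fun w : Z × Z => c₁ (z + w.1) * c₂ (z + w.2)).aestronglyMeasurable)
      (fun z => Eventually.of_forall fun w => hB _ _) (integrable_const _)
      (Eventually.of_forall fun w => by fun_prop)
  have hmem : ∀ {f : Z → ℂ}, Continuous f → MemLp f 2 (haarProb Z) := fun hf =>
    hf.memLp_of_hasCompactSupport (HasCompactSupport.of_compactSpace _)
  refine ⟨fun g => hmem (by fun_prop), hmem hlc, fun F hF => ?_⟩
  have hpt : ∀ z, Tendsto (fun N => ((F N).card : ℂ)⁻¹ *
      (∑ g ∈ F N, c₁ (z + a (φ g)) * c₂ (z + a (ψ g)))) atTop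
      (𝓝 (∫ w, c₁ (z + w.1) * c₂ (z + w.2) ∂pairMeasure a φ ψ)) := fun z => by
    have h := hF.tendsto_finsetAvg_integral_pairMeasure a φ ψ
      (f := fun w : Z × Z => c₁ (z + w.1) * c₂ (z + w.2)) (by fun_prop)
    simpa [finsetAvg, Complex.real_smul] using h
  have hbd : ∀ N z, ‖((F N).card : ℂ)⁻¹ *
      (∑ g ∈ F N, c₁ (z + a (φ g)) * c₂ (z + a (ψ g)))‖ ≤ ‖c₁‖ * ‖c₂‖ := fun N z => by
    have h := finsetAvg.norm_le_of_forall_le (F N) (by positivity)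
      (fun g => hB (z + a (φ g)) (z + a (ψ g)))
    simpa [finsetAvg, Complex.real_smul] using h
  have hui : UnifIntegrable (fun N z => ((F N).card : ℂ)⁻¹ *
      (∑ g ∈ F N, c₁ (z + a (φ g)) * c₂ (z + a (ψ g)))) 2 (haarProb Z) := by
    intro ε hε
    obtain ⟨δ, hδ, h⟩ := unifIntegrable_const (ι := ℕ) one_le_two ENNReal.ofNat_ne_top
      (memLp_const (μ := haarProb Z) (p := 2) (‖c₁‖ * ‖c₂‖)) hε
    refine ⟨δ, hδ, fun N s hs hsδ => (eLpNorm_mono fun z => ?_).trans (h N s hs hsδ)⟩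
    rw [norm_indicator_eq_indicator_norm, norm_indicator_eq_indicator_norm]
    exact Set.indicator_le_indicator ((hbd N z).trans (le_abs_self _))
  exact tendsto_Lp_finite_of_tendsto_ae one_le_two (by simp)
    (fun N => (by fun_prop : Continuous _).aestronglyMeasurable) (hmem hlc) hui
    (Eventually.of_forall hpt)

/-- For bounded Borel functions on `Z` the double averages converge to the integral over
`Z_{φ,ψ}`. -/
theorem isUCLimL2_of_bounded [T2Space Z] {h₁ h₂ : Z → ℂ} {C₁ C₂ : ℝ} (hm₁ : Measurable h₁)
    (hm₂ : Measurable h₂) (hC₁ : ∀ z, ‖h₁ z‖ ≤ C₁) (hC₂ : ∀ z, ‖h₂ z‖ ≤ C₂) :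
    IsUCLimL2 (haarProb Z) (fun (g : G) z => h₁ (z + a (φ g)) * h₂ (z + a (ψ g)))
      (fun z => ∫ w, h₁ (z + w.1) * h₂ (z + w.2) ∂pairMeasure a φ ψ) := by
  -- the approximation is applied to either function in turn
  refine isUCLimL2_of_forall_continuous measurable_fst measurable_snd hm₁ hm₂ hC₁ hC₂ fun c₁ => ?_
  simp only [mul_comm (c₁ _)]
  refine isUCLimL2_of_forall_continuous measurable_snd measurable_fst hm₂
    c₁.continuous.measurable hC₂ c₁.norm_coe_le_norm fun c₂ => ?_
  simp only [mul_comm (c₂ _)]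
  exact isUCLimL2_of_continuous a φ ψ c₁ c₂

end Rotation

/-! ### Transfer from the Kronecker factor -/

section Transfer

variable {X Z : Type*} [MeasurableSpace X] [MeasurableSpace Z] {μ : Measure X}

/-- An almost everywhere bounded function agrees almost everywhere with a bounded measurable one. -/
theorem exists_measurable_forall_norm_le {ν : Measure Z} {h : Z → ℂ} (hm : AEStronglyMeasurable h ν)
    {C : ℝ} (hC : 0 ≤ C) (hb : ∀ᵐ z ∂ν, ‖h z‖ ≤ C) :
    ∃ h' : Z → ℂ, Measurable h' ∧ (∀ z, ‖h' z‖ ≤ C) ∧ h =ᵐ[ν] h' := by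
  have hk : Measurable (hm.mk h) := hm.stronglyMeasurable_mk.measurable
  refine ⟨{z | ‖hm.mk h z‖ ≤ C}.indicator (hm.mk h),
    hk.indicator (measurableSet_le hk.norm measurable_const), fun z => ?_, ?_⟩
  · by_cases hz : z ∈ {z | ‖hm.mk h z‖ ≤ C}
    · rw [Set.indicator_of_mem hz]; exact hz
    · rw [Set.indicator_of_notMem hz, norm_zero]; exact hC
  · filter_upwards [hb, hm.ae_eq_mk] with z h1 h2
    rw [h2] at h1
    rw [Set.indicator_of_mem (by exact h1), h2]

/-- The image in a factor of an essentially bounded function has a bounded measurable version. -/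
theorem IsFactorImage.exists_measurable_forall_norm_le [IsFiniteMeasure μ] {π : X → Z} {f : X → ℂ}
    {h : Z → ℂ} (hh : IsFactorImage μ π f h) (hπ : Measurable π) (hf : MemLp f ∞ μ) :
    ∃ (h' : Z → ℂ) (C : ℝ), Measurable h' ∧ (∀ z, ‖h' z‖ ≤ C) ∧ h =ᵐ[μ.map π] h' := by
  obtain ⟨C, hC, hb⟩ := exists_ae_norm_le
    (hf.condExp (m := MeasurableSpace.comap π inferInstance) le_top)
  have hb' : ∀ᵐ z ∂μ.map π, ‖h z‖ ≤ C := by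
    have h1 : ∀ᵐ x ∂μ, ‖h (π x)‖ ≤ C := by
      filter_upwards [hb, hh.condExp_eq] with x hx he
      rwa [he] at hx
    obtain ⟨k, hk, he⟩ := hh.aestronglyMeasurable
    have h2 : ∀ᵐ z ∂μ.map π, ‖k z‖ ≤ C := by
      rw [ae_map_iff hπ.aemeasurable (measurableSet_le hk.measurable.norm measurable_const)]
      filter_upwards [h1, ae_of_ae_map hπ.aemeasurable he] with x h3 h4
      rwa [← h4]
    filter_upwards [h2, he] with z h3 h4
    rwa [h4]
  obtain ⟨h', h1, h2, h3⟩ := _root_.exists_measurable_forall_norm_le hh.aestronglyMeasurable hC hb'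
  exact ⟨h', C, h1, h2, h3⟩

end Transfer

section Main

variable {G : Type*} [AddCommGroup G] {Z : Type*} [AddCommGroup Z] [TopologicalSpace Z]
  [IsTopologicalAddGroup Z] [CompactSpace Z] [SecondCountableTopology Z]
  [MeasurableSpace Z] [BorelSpace Z] (a : G →+ Z) (φ ψ : G →+ G) {h₁ h₂ k₁ k₂ : Z → ℂ}

/-- Changing functions on null sets of `Z` affects the integrals over `Z_{φ,ψ}` only for a null set
of base points, although `Z_{φ,ψ}` itself may be a null set of `Z × Z`. -/
theorem ae_mul_ae_eq_pairMeasure (he₁ : h₁ =ᵐ[haarProb Z] k₁) (he₂ : h₂ =ᵐ[haarProb Z] k₂) :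
    ∀ᵐ z ∂haarProb Z, (fun w : Z × Z => h₁ (z + w.1) * h₂ (z + w.2)) =ᵐ[pairMeasure a φ ψ]
      fun w => k₁ (z + w.1) * k₂ (z + w.2) := by
  filter_upwards [ae_ae_add_haarProb (ν := pairMeasure a φ ψ) measurable_fst he₁,
    ae_ae_add_haarProb (ν := pairMeasure a φ ψ) measurable_snd he₂] with z h1 h2
  filter_upwards [h1, h2] with w h3 h4
  rw [h3, h4]

theorem isUCLimL2_of_ae_eq_bounded [T2Space Z] {C₁ C₂ : ℝ} (hm₁ : Measurable k₁)
    (hm₂ : Measurable k₂)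
    (hC₁ : ∀ z, ‖k₁ z‖ ≤ C₁) (hC₂ : ∀ z, ‖k₂ z‖ ≤ C₂) (he₁ : h₁ =ᵐ[haarProb Z] k₁)
    (he₂ : h₂ =ᵐ[haarProb Z] k₂) :
    IsUCLimL2 (haarProb Z) (fun (g : G) z => h₁ (z + a (φ g)) * h₂ (z + a (ψ g)))
      (fun z => ∫ w, h₁ (z + w.1) * h₂ (z + w.2) ∂pairMeasure a φ ψ) := by
  refine (isUCLimL2_of_bounded a φ ψ hm₁ hm₂ hC₁ hC₂).congr (fun g => ?_) ?_
  · have hq : ∀ c : Z, Measure.QuasiMeasurePreserving (fun z => z + c) (haarProb Z) (haarProb Z) :=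
      fun c => (measurePreserving_add_right _ c).quasiMeasurePreserving
    filter_upwards [(hq (a (φ g))).ae he₁, (hq (a (ψ g))).ae he₂] with z h1 h2
    rw [h1, h2]
  · filter_upwards [ae_mul_ae_eq_pairMeasure a φ ψ he₁ he₂] with z hz
    exact (integral_congr_ae hz).symm

end Main

theorem mainTheorem5
    {G : Type*} [AddCommGroup G] [Countable G]
    {X : Type*} [MeasurableSpace X] (μ : Measure X) [IsProbabilityMeasure μ]
    [AddAction G X] [MeasurableConstVAdd G X] [ErgodicVAdd G X μ]
    {Z : Type*} [AddCommGroup Z] [TopologicalSpace Z] [IsTopologicalAddGroup Z]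
    [CompactSpace Z] [T2Space Z] [SecondCountableTopology Z] [MeasurableSpace Z] [BorelSpace Z]
    (a : G →+ Z) (π : X → Z) (hπ : IsKroneckerFactor μ a π)
    (φ ψ : G →+ G) (hφψ : IsAdmissiblePair φ ψ) :
    IsCharacteristicFactor (MeasurableSpace.comap π inferInstance) μ φ ψ ∧
    ∀ f₁ f₂ : X → ℂ, MemLp f₁ ∞ μ → MemLp f₂ ∞ μ →
      ∀ h₁ h₂ : Z → ℂ, IsFactorImage μ π f₁ h₁ → IsFactorImage μ π f₂ h₂ →
        (∀ᵐ x ∂μ, Integrable (fun w : Z × Z => h₁ (π x + w.1) * h₂ (π x + w.2))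
          (pairMeasure a φ ψ)) ∧
        IsUCLimL2 μ (fun (g : G) x => f₁ (φ g +ᵥ x) * f₂ (ψ g +ᵥ x))
          (fun x => ∫ w, h₁ (π x + w.1) * h₂ (π x + w.2) ∂(pairMeasure a φ ψ)) ∧
        IsUCLimL2 μ (fun (g : G) x => h₁ (π x + a (φ g)) * h₂ (π x + a (ψ g)))
          (fun x => ∫ w, h₁ (π x + w.1) * h₂ (π x + w.2) ∂(pairMeasure a φ ψ)) := by
  have hchar := hπ.isCharacteristicFactor hφψ
  refine ⟨hchar, fun f₁ f₂ hf₁ hf₂ h₁ h₂ hh₁ hh₂ => ?_⟩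
  have hmp := hπ.measurePreserving
  obtain ⟨k₁, C₁, hm₁, hC₁, he₁⟩ := hh₁.exists_measurable_forall_norm_le hmp.measurable hf₁
  obtain ⟨k₂, C₂, hm₂, hC₂, he₂⟩ := hh₂.exists_measurable_forall_norm_le hmp.measurable hf₂
  rw [hmp.map_eq] at he₁ he₂
  have hZ : IsUCLimL2 μ (fun (g : G) x => h₁ (π x + a (φ g)) * h₂ (π x + a (ψ g)))
      (fun x => ∫ w, h₁ (π x + w.1) * h₂ (π x + w.2) ∂(pairMeasure a φ ψ)) :=
    (isUCLimL2_of_ae_eq_bounded a φ ψ hm₁ hm₂ hC₁ hC₂ he₁ he₂).comp_measurePreserving hmp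
  refine ⟨?_, ?_, hZ⟩
  · filter_upwards [hmp.quasiMeasurePreserving.ae (ae_mul_ae_eq_pairMeasure a φ ψ he₁ he₂)]
      with x hx
    refine (memLp_one_iff_integrable.1 ?_).congr hx.symm
    exact memLp_mul_of_bounded (by fun_prop) (by fun_prop) (fun _ => hC₁ _) (fun _ => hC₂ _) 1
  · refine ((hchar f₁ f₂ hf₁ hf₂).add hZ).congr (fun g => ?_)
      (Eventually.of_forall fun x => zero_add _)
    filter_upwards [ae_vadd_of_ae (φ g) hh₁.condExp_eq, ae_vadd_of_ae (ψ g) hh₂.condExp_eq,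
      hπ.equivariant (φ g), hπ.equivariant (ψ g)] with x h1 h2 h3 h4
    rw [h1, h2, Function.comp_apply, Function.comp_apply, h3, h4, sub_add_cancel]
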